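/- Let $n\ge 1$, $\alpha\in(0,1)$ and $\mu_{n,\alpha}=2^\alpha\pi^{-n/2}\,\Gamma\big(\tfrac{n+\alpha+1}{2}\big)/\Gamma\big(\tfrac{1-\alpha}{2}\big)$. For $\varphi\in C^\infty_c(\mathbb R^n;\mathbb R^n)$ and $g\in L^\infty(\mathbb R^n)$ set $$\mathrm{div}^\alpha\varphi(x)=\mu_{n,\alpha}\int_{\mathbb R^n}\frac{(\varphi(y)-\varphi(x))\cdot(y-x)}{|y-x|^{n+\alpha+1}}\,dy,\qquad \mathrm{div}^\alpha_{\mathrm{NL}}(g,\varphi)(x)=\mu_{n,\alpha}\int_{\mathbb R^n}\frac{(g(y)-g(x))(\varphi(y)-\varphi(x))\cdot(y-x)}{|y-x|^{n+\alpha+1}}\,dy .$$ For $p\in[1,\infty]$, $f\in BV^{\alpha,p}_{\mathrm{loc}}(\mathbb R^n)$ means that $f\in L^p(\mathbb R^n)$ and, for every bounded open $A\subset\mathbb R^n$, $\sup\{\int_{\mathbb R^n} f\,\mathrm{div}^\alpha\varphi\,dx:\varphi\in C^\infty_c(\mathbb R^n;\mathbb R^n),\ \|\varphi\|_\infty\le1,\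 \operatorname{supp}\varphi\subset A\}<\infty$. Let $\mathscr M_{\mathrm{loc}}(\mathbb R^n;\mathbb R^n)$ be the set of $\mathbb R^n$-valued Radon measures, i.e. $\sigma$-additive $\mathbb R^n$-valued set functions on the bounded Borel sets. The fractional variation measure of $f$ is the measure $D^\alpha f\in\mathscr M_{\mathrm{loc}}(\mathbb R^n;\mathbb R^n)$ with $\int f\,\mathrm{div}^\alpha\varphi\,dx=-\int\varphi\cdot dD^\alpha f$ for all $\varphi\in C^\infty_c(\mathbb R^n;\mathbb R^n)$, and $|D^\alpha f|$ is its total variation; $f\in BV^{\alpha,p}(\mathbb R^n)$ means that moreover $|D^\alpha f|(\mathbb R^n)<\infty$. A measure $D^\alpha_{\mathrm{NL}}(f,g)\in\mathscr M_{\mathrm{loc}}(\mathbb R^n;\mathbb R^n)$ is a non-local fractional $\alpha$-gradient measure of $f,g\in L^\infty(\mathbb R^n)$ if $\int f\,\mathrm{div}^\alpha_{\mathrm{NL}}(g,\varphi)\,dx=\int\varphi\cdot dD^\alpha_{\mathrm{NL}}(f,g)$ for all $\varphi\in C^\infty_c(\mathbb R^n;\mathbb R^n)$. Finally, for $u\in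 L^1_{\mathrm{loc}}(\mathbb R^n)$, let $\mathscr R_u$ be the set of $x\in\mathbb R^n$ at which the limit $u^\star(x)=\lim_{r\to0^+}\frac1{|B_r(x)|}\int_{B_r(x)}u(y)\,dy$ exists in $\mathbb R$. Let $E\subset\mathbb R^n$ be such that $\chi_E\in BV^{\alpha,\infty}_{\mathrm{loc}}(\mathbb R^n)$. Then the measure $D^\alpha\chi_E$ exists and is unique, the measure $D^\alpha_{\mathrm{NL}}(\chi_E,\chi_E)\in\mathscr M_{\mathrm{loc}}(\mathbb R^n;\mathbb R^n)$ exists and is unique, and there is $\overline{\chi_E}\in L^\infty(\mathbb R^n,|D^\alpha\chi_E|)$ such that $$D^\alpha_{\mathrm{NL}}(\chi_E,\chi_E)=(1-2\,\overline{\chi_E})\,D^\alpha\chi_E\quad\text{in }\mathscr M_{\mathrm{loc}}(\mathbb R^n;\mathbb R^n),$$ $0\le\overline{\chi_E}\le1$ $|D^\alpha\chi_E|$-a.e. in $\mathbb R^n$, and $\overline{\chi_E}=\chi_E^\star$ $|D^\alpha\chi_E|$-a.e. in $\mathscr R_{\chi_E}$. If in addition $\chi_E\in BV^{\alpha,1}(\mathbb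 R^n)$, then $D^\alpha\chi_E$ and $D^\alpha_{\mathrm{NL}}(\chi_E,\chi_E)$ extend to finite $\mathbb R^n$-valued measures on all Borel sets of $\mathbb R^n$, and $$D^\alpha_{\mathrm{NL}}(\chi_E,\chi_E)(\mathbb R^n)=\int_{\mathbb R^n}\overline{\chi_E}\,dD^\alpha\chi_E=0 .$$ -/

import Mathlib

open Set Filter Topology MeasureTheory
open scoped ENNReal ContDiff

noncomputable section

namespace FracVar

/-- The Euclidean space `ℝⁿ`. -/
abbrev Rn (n : ℕ) : Type := EuclideanSpace ℝ (Fin n)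

/-- The Euclidean scalar product as a continuous bilinear map. -/
def dotL (n : ℕ) : Rn n →L[ℝ] Rn n →L[ℝ] ℝ := innerSL ℝ

/-- The characteristic function `χ_E`. -/
def chi {n : ℕ} (E : Set (Rn n)) : Rn n → ℝ := E.indicator fun _ => 1

/-! ### Locally finite vector-valued Radon measures -/

/-- A vector-valued Radon measure in `𝓜_loc(ℝⁿ; ℝⁿ)`: an `ℝⁿ`-valued, `σ`-additive set function
on the bounded Borel sets (by convention it takes the value `0` on all other sets). -/
structure LocVectorMeasure (n : ℕ) where
  toFun : Set (Rn n) → Rn n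
  eq_zero : ∀ A, ¬ (MeasurableSet A ∧ Bornology.IsBounded A) → toFun A = 0
  hasSum_iUnion : ∀ A : ℕ → Set (Rn n), (∀ i, MeasurableSet (A i)) →
    Pairwise (fun i j => Disjoint (A i) (A j)) → Bornology.IsBounded (⋃ i, A i) →
    HasSum (fun i => toFun (A i)) (toFun (⋃ i, A i))

namespace LocVectorMeasure

variable {n : ℕ}

theorem empty_eq_zero (μ : LocVectorMeasure n) : μ.toFun ∅ = 0 := by
  have h := μ.hasSum_iUnion (fun _ => ∅) (fun _ => MeasurableSet.empty)
    (fun _ _ _ => disjoint_bot_left) (by simp)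
  exact tendsto_nhds_unique tendsto_const_nhds h.summable.tendsto_atTop_zero

open scoped Classical in
/-- For a bounded Borel set `K`, the restriction `A ↦ μ (A ∩ K)` as a finite vector measure on the
whole Borel `σ`-algebra (by convention it is `0` for all other `K`). -/
def onSet (μ : LocVectorMeasure n) (K : Set (Rn n)) : VectorMeasure (Rn n) (Rn n) :=
  if hK : MeasurableSet K ∧ Bornology.IsBounded K then
    { measureOf' := fun A => if MeasurableSet A then μ.toFun (A ∩ K) else 0
      empty' := by simp [μ.empty_eq_zero]
      not_measurable' := fun _ hA => if_neg hA
      m_iUnion' := by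
        intro A hA hd
        have h := μ.hasSum_iUnion (fun i => A i ∩ K) (fun i => (hA i).inter hK.1)
          (fun i j hij => (hd hij).mono inter_subset_left inter_subset_left)
          (hK.2.subset (iUnion_subset fun i => inter_subset_right))
        simpa [hA, MeasurableSet.iUnion hA, iUnion_inter] using h }
  else 0

/-- The restriction of `μ` to the open ball of radius `R` centred at the origin. -/
def onBall (μ : LocVectorMeasure n) (R : ℝ) : VectorMeasure (Rn n) (Rn n) :=
  μ.onSet (Metric.ball 0 R)

/-- The total variation `|μ|`, a positive Borel measure on `ℝⁿ`: the (increasing) supremum of the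
total variations of the restrictions of `μ` to the balls `B_k`. -/
def variation (μ : LocVectorMeasure n) : Measure (Rn n) :=
  ⨆ k : ℕ, (μ.onBall (k : ℝ)).variation

/-- `ν = h μ` in `𝓜_loc(ℝⁿ; ℝⁿ)`, that is, `ν(A) = ∫_A h dμ` for every bounded Borel set `A`,
the integral being well defined. -/
def EqDensity (ν : LocVectorMeasure n) (h : Rn n → ℝ) (μ : LocVectorMeasure n) : Prop :=
  ∀ A : Set (Rn n), MeasurableSet A → Bornology.IsBounded A →
    (μ.onSet A).Integrable h ∧ ν.toFun A = ∫ᵛ x, h x ∂•(μ.onSet A)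

/-- The finite vector measure `V ∈ 𝓜(ℝⁿ; ℝⁿ)` is the extension of `μ` to all Borel sets. -/
def ExtendsTo (μ : LocVectorMeasure n) (V : VectorMeasure (Rn n) (Rn n)) : Prop :=
  ∀ A : Set (Rn n), MeasurableSet A → Bornology.IsBounded A → V A = μ.toFun A

end LocVectorMeasure

/-! ### Fractional operators -/

/-- The renormalization constant `μ_{n,α}`. -/
def muConst (n : ℕ) (α : ℝ) : ℝ :=
  2 ^ α * Real.pi ^ (-(n : ℝ) / 2) *
    (Real.Gamma (((n : ℝ) + α + 1) / 2) / Real.Gamma ((1 - α) / 2))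

/-- The fractional `α`-divergence of `φ` at `x`. -/
def fracDiv {n : ℕ} (α : ℝ) (φ : Rn n → Rn n) (x : Rn n) : ℝ :=
  muConst n α * ∫ y, inner ℝ (φ y - φ x) (y - x) / ‖y - x‖ ^ ((n : ℝ) + α + 1)

/-- The non-local fractional `α`-divergence of the pair `(g, φ)` at `x`. -/
def fracDivNL {n : ℕ} (α : ℝ) (g : Rn n → ℝ) (φ : Rn n → Rn n) (x : Rn n) : ℝ :=
  muConst n α *
    ∫ y, (g y - g x) * inner ℝ (φ y - φ x) (y - x) / ‖y - x‖ ^ ((n : ℝ) + α + 1)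

/-- `φ ∈ C_c^∞(ℝⁿ; ℝⁿ)`. -/
def IsTest {n : ℕ} (φ : Rn n → Rn n) : Prop :=
  ContDiff ℝ ∞ φ ∧ HasCompactSupport φ

/-- `f ∈ BV^{α,p}_loc(ℝⁿ)`. -/
def MemBVloc {n : ℕ} (α : ℝ) (p : ℝ≥0∞) (f : Rn n → ℝ) : Prop :=
  MemLp f p volume ∧
  ∀ A : Set (Rn n), IsOpen A → IsCompact (closure A) →
    BddAbove {t : ℝ | ∃ φ : Rn n → Rn n, IsTest φ ∧ (∀ x, ‖φ x‖ ≤ 1) ∧ tsupport φ ⊆ A ∧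
      t = ∫ x, f x * fracDiv α φ x}

/-- `D` is the fractional `α`-variation measure `D^α f`: for all `φ ∈ C_c^∞(ℝⁿ; ℝⁿ)`,
`∫ f div^α φ dx = - ∫ φ · dD` (the last integral is over any ball containing `supp φ`). -/
def IsFracVariation {n : ℕ} (α : ℝ) (f : Rn n → ℝ) (D : LocVectorMeasure n) : Prop :=
  ∀ φ : Rn n → Rn n, IsTest φ → ∀ R : ℝ, tsupport φ ⊆ Metric.ball 0 R →
    ∫ x, f x * fracDiv α φ x = - ∫ᵛ x, φ x ∂[dotL n; D.onBall R]

/-- `f ∈ BV^{α,p}(ℝⁿ)`: `f ∈ BV^{α,p}_loc(ℝⁿ)` and `|D^α f|(ℝⁿ) < ∞`. -/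
def MemBV {n : ℕ} (α : ℝ) (p : ℝ≥0∞) (f : Rn n → ℝ) : Prop :=
  MemBVloc α p f ∧ ∃ D : LocVectorMeasure n, IsFracVariation α f D ∧ D.variation univ < ⊤

/-- `N` is a non-local fractional `α`-gradient measure of the pair `(f, g)`: for all
`φ ∈ C_c^∞(ℝⁿ; ℝⁿ)`, `∫ f div^α_NL(g, φ) dx = ∫ φ · dN`
(the last integral is over any ball containing `supp φ`). -/
def IsNLGradientMeasure {n : ℕ} (α : ℝ) (f g : Rn n → ℝ) (N : LocVectorMeasure n) : Prop :=
  ∀ φ : Rn n → Rn n, IsTest φ → ∀ R : ℝ, tsupport φ ⊆ Metric.ball 0 R →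
    ∫ x, f x * fracDivNL α g φ x = ∫ᵛ x, φ x ∂[dotL n; N.onBall R]

/-! ### Precise representative -/

/-- The set `𝓡_u` of the points at which the averages of `u` on balls have a finite limit. -/
def preciseSet {n : ℕ} (u : Rn n → ℝ) : Set (Rn n) :=
  {x | ∃ l : ℝ, Tendsto (fun r : ℝ => ⨍ y in Metric.ball x r, u y) (𝓝[>] 0) (𝓝 l)}

/-- The precise representative `u^⋆`, meaningful at the points of `preciseSet u`. -/
def preciseRep {n : ℕ} (u : Rn n → ℝ) (x : Rn n) : ℝ :=
  limUnder (𝓝[>] (0 : ℝ)) fun r : ℝ => ⨍ y in Metric.ball x r, u y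

end FracVar

end

noncomputable section

namespace FracVar

/-! ### Vector measures given by a density -/

section Density

variable {X E F G : Type*} [MeasurableSpace X]
  [NormedAddCommGroup E] [NormedSpace ℝ E]
  [NormedAddCommGroup F] [NormedSpace ℝ F] [CompleteSpace F]
  [NormedAddCommGroup G] [NormedSpace ℝ G] [CompleteSpace G]

/-! Write $f=\chi_E$ and let $g_k=\rho_k*f$ for smooth radially decreasing mollifiers $\rho_k$.
Splitting the difference of a product gives the exact Leibniz rule
$\mathrm{div}^\alpha(g_k\varphi)=g_k\,\mathrm{div}^\alpha\varphi+\varphi\cdot\nabla^\alpha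
g_k+\mathrm{div}^\alpha_{\mathrm{NL}}(g_k,\varphi)$. Integrate it against $f$. By duality, $\int
f\varphi\cdot\nabla^\alpha g_k=-\int f\,\mathrm{div}^\alpha(\rho_k*(f\varphi))$, and
$\rho_k*(f\varphi)-g_k\varphi\to0$ uniformly, however rough $f$ is. Both pairings with a fractional
divergence therefore become $-\int g_k\varphi\cdot dD^\alpha f$ up to $o(1)$, so that $$\int
f\,\mathrm{div}^\alpha_{\mathrm{NL}}(g_k,\varphi)=-\int f g_k\,\mathrm{div}^\alpha\varphi-2\int
g_k\varphi\cdot dD^\alpha f+o(1).$$ The left side converges to the same expression with $g_k$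
replaced by $f$. Since $f^2=f$, the first term on the right tends to $\int\varphi\cdot dD^\alpha f$.
If $h$ is a weak limit of the $g_k$ relative to $|D^\alpha f|$, the density $1-2h$ appears. This is
`exists_density_nonlocal`, and $h$ is $\overline{\chi_E}$.

The bounds $0\le h\le1$ pass to the weak limit. A radially decreasing mollification is a
superposition of averages over balls, so $g_k(x)\to f^\star(x)$ at every $x\in\mathscr R_f$
(`tendsto_mollify_of_tendsto_average`). A weak limit agrees a.e. with a pointwise limit where there
is one.

The measure $D^\alpha f$ itself is a weak-star limit of the fields $\nabla^\alpha g_k$, which the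
definition of $BV^{\alpha,\infty}_{\mathrm{loc}}$ bounds in $L^1_{\mathrm{loc}}$
(`exists_density_fracVariation`). Every measure is handled as a density with respect to one finite
measure $m$.

If $f\in L^1$ and $|D^\alpha f|$ is finite, testing with cutoffs $\eta_k e\to e$ makes both
fractional divergences vanish in the limit. Hence $\sigma$ and $(1-2h)\sigma$ have zero integral,
and so has $h\sigma$. -/

theorem isFiniteMeasure_variation_withDensityᵥ {m : Measure X} {σ : X → F} (hσ : Integrable σ m) :
    IsFiniteMeasure (m.withDensityᵥ σ).variation := by
  rw [Measure.variation_withDensityᵥ hσ]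
  exact ⟨by simpa using! hσ.2⟩

theorem absolutelyContinuous_variation_withDensityᵥ {m : Measure X} {σ : X → F}
    (hσ : Integrable σ m) : (m.withDensityᵥ σ).variation ≪ m := by
  rw [Measure.variation_withDensityᵥ hσ]
  exact withDensity_absolutelyContinuous _ _

omit [NormedSpace ℝ E] [NormedSpace ℝ F] [CompleteSpace F] in
theorem integrable_norm_mul_of_integrable_withDensity {m : Measure X} {σ : X → F} {f : X → E}
    (hσ : Integrable σ m) (hf : Integrable f (m.withDensity fun x => ‖σ x‖ₑ)) :
    Integrable (fun x => ‖σ x‖ * ‖f x‖) m := by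
  have h := (integrable_withDensity_iff_integrable_smul₀' hσ.aestronglyMeasurable.enorm
    (by simp)).1 hf.norm
  simpa using h

omit [CompleteSpace F] [CompleteSpace G] in
theorem aestronglyMeasurable_apply_apply_withDensity {m : Measure X} {σ : X → F} {f : X → E}
    (B : E →L[ℝ] F →L[ℝ] G)
    (hσ : Integrable σ m) (hf : AEStronglyMeasurable f (m.withDensity fun x => ‖σ x‖ₑ)) :
    AEStronglyMeasurable (fun x => B (f x) (σ x)) m := by
  obtain ⟨g, hg, hfg⟩ := hf
  have h1 : AEStronglyMeasurable (fun x => B (g x) (σ x)) m :=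
    B.aestronglyMeasurable_comp₂ hg.aestronglyMeasurable hσ.aestronglyMeasurable
  refine h1.congr ?_
  have := (ae_withDensity_iff' hσ.aestronglyMeasurable.enorm).1 hfg
  filter_upwards [this] with x hx
  by_cases h : σ x = 0
  · simp [h]
  · rw [hx (by simpa using h)]

omit [CompleteSpace F] [CompleteSpace G] in
theorem integrable_apply_apply_withDensity {m : Measure X} {σ : X → F} {f : X → E}
    (B : E →L[ℝ] F →L[ℝ] G)
    (hσ : Integrable σ m) (hf : Integrable f (m.withDensity fun x => ‖σ x‖ₑ)) :
    Integrable (fun x => B (f x) (σ x)) m := by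
  refine ((integrable_norm_mul_of_integrable_withDensity hσ hf).const_mul ‖B‖).mono'
    (aestronglyMeasurable_apply_apply_withDensity B hσ hf.1) (Eventually.of_forall fun x => ?_)
  calc ‖B (f x) (σ x)‖ ≤ ‖B‖ * ‖f x‖ * ‖σ x‖ := B.le_opNorm₂ _ _
    _ = _ := by ring

/-- The integral against a vector measure with density. -/
theorem vectorIntegral_withDensityᵥ {m : Measure X} {σ : X → F} {f : X → E}
    (B : E →L[ℝ] F →L[ℝ] G)
    (hσ : Integrable σ m) (hf : Integrable f (m.withDensity fun x => ‖σ x‖ₑ)) :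
    (m.withDensityᵥ σ).integral f B = ∫ x, B (f x) (σ x) ∂m := by
  have hvar := Measure.variation_withDensityᵥ hσ
  have hfin := isFiniteMeasure_variation_withDensityᵥ hσ
  set ν := m.withDensity fun x => ‖σ x‖ₑ with hν
  refine Integrable.induction (P := fun f =>
    (m.withDensityᵥ σ).integral f B = ∫ x, B (f x) (σ x) ∂m) ?_ ?_ ?_ ?_ hf
  · intro c s hs _
    rw [VectorMeasure.integral_indicator hs,
      VectorMeasure.setIntegral_const, withDensityᵥ_apply hσ hs,
      ← ContinuousLinearMap.integral_comp_comm _ hσ.integrableOn, ← integral_indicator hs]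
    congr 1 with x
    by_cases hx : x ∈ s <;> simp [hx]
  · intro f g _ hf hg hf' hg'
    rw [VectorMeasure.integral_add (by rwa [VectorMeasure.Integrable, hvar])
      (by rwa [VectorMeasure.Integrable, hvar]), hf', hg',
      ← integral_add (integrable_apply_apply_withDensity B hσ hf)
        (integrable_apply_apply_withDensity B hσ hg)]
    simp
  · have h1 : Continuous fun f : X →₁[ν] E => (m.withDensityᵥ σ).integral f B := by
      rw [← hvar]
      exact VectorMeasure.continuous_integral
    refine isClosed_eq h1 ?_
    -- Closedness for the density argument: the right-hand side is Lipschitz in $f\in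
    -- L^1(|\sigma|m)$, with constant $\|B\|$.
    have : LipschitzWith ‖B‖₊ fun f : X →₁[ν] E => ∫ x, B (f x) (σ x) ∂m := by
      refine LipschitzWith.of_dist_le_mul fun f g => ?_
      have hf := L1.integrable_coeFn f
      have hg := L1.integrable_coeFn g
      rw [dist_eq_norm, ← integral_sub (integrable_apply_apply_withDensity B hσ hf)
        (integrable_apply_apply_withDensity B hσ hg)]
      refine (norm_integral_le_of_norm_le
        ((integrable_norm_mul_of_integrable_withDensity hσ (hf.sub hg)).const_mul ‖B‖)
        (Eventually.of_forall fun x => ?_)).trans (le_of_eq ?_)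
      · have : B (f x) (σ x) - B (g x) (σ x) = B (f x - g x) (σ x) := by simp
        rw [this]
        calc _ ≤ ‖B‖ * ‖f x - g x‖ * ‖σ x‖ := B.le_opNorm₂ _ _
          _ = _ := by simp; ring
      · have h2 : ∀ k : X → ℝ≥0∞, AEMeasurable k ν →
            ∫⁻ x, k x ∂ν = ∫⁻ x, ‖σ x‖ₑ * k x ∂m := fun k hk =>
          lintegral_withDensity_eq_lintegral_mul₀' hσ.aestronglyMeasurable.enorm hk
        have h3 : AEMeasurable (fun x => edist (f x) (g x)) ν := by
          simpa [edist_eq_enorm_sub] using (hf.sub hg).1.enorm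
        rw [integral_const_mul, L1.dist_def, h2 _ h3,
          integral_eq_lintegral_of_nonneg_ae (Eventually.of_forall fun x => by positivity)
          (integrable_norm_mul_of_integrable_withDensity hσ (hf.sub hg)).1]
        simp only [coe_nnnorm, Pi.sub_apply]
        congr 3 with x
        rw [ENNReal.ofReal_mul (norm_nonneg _), edist_eq_enorm_sub, ofReal_norm, ofReal_norm]
    exact this.continuous
  · intro f g hfg hf h
    rw [← VectorMeasure.integral_congr_ae (f := f) (by rwa [hvar]), h]
    refine integral_congr_ae ?_
    filter_upwards [(ae_withDensity_iff' hσ.aestronglyMeasurable.enorm).1 hfg] with x hx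
    by_cases h : σ x = 0
    · simp [h]
    · rw [hx (by simpa using h)]

omit [NormedSpace ℝ E] in
theorem integrable_withDensity_enorm_of_bound {m : Measure X} {σ : X → F} {f : X → E} {C : ℝ}
    (hσ : Integrable σ m) (hf : AEStronglyMeasurable f m) (hC : ∀ x, ‖f x‖ ≤ C) :
    Integrable f (m.withDensity fun x => ‖σ x‖ₑ) := by
  have := isFiniteMeasure_variation_withDensityᵥ hσ
  rw [Measure.variation_withDensityᵥ hσ] at this
  exact Integrable.of_bound (hf.mono_ac (withDensity_absolutelyContinuous _ _)) C
    (Eventually.of_forall hC)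

/-- Two vector measures with values in a Euclidean space have densities with respect to a common
finite measure. -/
theorem exists_common_density {ι : Type*} [Fintype ι]
    (V W : VectorMeasure X (EuclideanSpace ℝ ι)) :
    ∃ (m : Measure X) (_ : IsFiniteMeasure m) (σ τ : X → EuclideanSpace ℝ ι),
      Integrable σ m ∧ Integrable τ m ∧ V = m.withDensityᵥ σ ∧ W = m.withDensityᵥ τ := by
  let c (V : VectorMeasure X (EuclideanSpace ℝ ι)) (i : ι) : SignedMeasure X :=
    V.mapRange ((EuclideanSpace.proj i : EuclideanSpace ℝ ι →L[ℝ] ℝ) :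
      EuclideanSpace ℝ ι →+ ℝ) (EuclideanSpace.proj i).continuous
  have hc (V : VectorMeasure X (EuclideanSpace ℝ ι)) (i : ι) (A : Set X) : c V i A = V A i := rfl
  let m : Measure X := ∑ i, ((c V i).totalVariation + (c W i).totalVariation)
  have hle (i : ι) : (c V i).totalVariation + (c W i).totalVariation ≤ m := by
    refine Measure.le_iff.2 fun A _ => ?_
    simp only [m, Measure.finsetSum_apply]
    exact Finset.single_le_sum (f := fun i => ((c V i).totalVariation + (c W i).totalVariation) A)
      (fun _ _ => zero_le) (Finset.mem_univ i)
  have hm : IsFiniteMeasure m := by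
    refine ⟨?_⟩
    simp only [m, Measure.finsetSum_apply, ENNReal.sum_lt_top]
    intro i _
    exact measure_lt_top _ _
  have key : ∀ V' : VectorMeasure X (EuclideanSpace ℝ ι),
      (∀ i, (c V' i).totalVariation ≤ m) →
      ∃ σ : X → EuclideanSpace ℝ ι, Integrable σ m ∧ V' = m.withDensityᵥ σ := by
    intro V' hV'
    have hi (i : ι) : m.withDensityᵥ ((c V' i).rnDeriv m) = c V' i := by
      refine SignedMeasure.withDensityᵥ_rnDeriv_eq _ _ (VectorMeasure.AbsolutelyContinuous.mk ?_)
      intro A hAm hA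
      have h0 : (c V' i).totalVariation A = 0 := by
        refine le_antisymm ((hV' i A).trans ?_) zero_le
        rw [← Measure.toENNRealVectorMeasure_apply_measurable hAm, hA]
      have := (c V' i).norm_le_totalVariation A
      rw [measureReal_def, h0] at this
      simpa using this
    have hint : Integrable (fun x => WithLp.toLp 2 fun i => (c V' i).rnDeriv m x :
        X → EuclideanSpace ℝ ι) m :=
      Integrable.of_eval_piLp fun i => SignedMeasure.integrable_rnDeriv _ _
    refine ⟨_, hint, ?_⟩
    ext A hA i
    rw [withDensityᵥ_apply hint hA, ← hc, ← hi,
      withDensityᵥ_apply (SignedMeasure.integrable_rnDeriv _ _) hA]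
    exact ((EuclideanSpace.proj i : EuclideanSpace ℝ ι →L[ℝ] ℝ).integral_comp_comm
      hint.integrableOn)
  obtain ⟨σ, hσ, hV⟩ := key V fun i => (Measure.le_add_right le_rfl).trans (hle i)
  obtain ⟨τ, hτ, hW⟩ := key W fun i => (Measure.le_add_left le_rfl).trans (hle i)
  exact ⟨m, hm, σ, τ, hσ, hτ, hV, hW⟩

end Density

/-! ### Locally finite vector measures given by densities -/

namespace LocVectorMeasure

variable {n : ℕ}

@[ext]
theorem ext {μ ν : LocVectorMeasure n}
    (h : ∀ A, MeasurableSet A → Bornology.IsBounded A → μ.toFun A = ν.toFun A) : μ = ν := by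
  have : μ.toFun = ν.toFun := by
    funext A
    by_cases hA : MeasurableSet A ∧ Bornology.IsBounded A
    · exact h A hA.1 hA.2
    · rw [μ.eq_zero A hA, ν.eq_zero A hA]
  cases μ; cases ν; congr

theorem onSet_apply (μ : LocVectorMeasure n) {K A : Set (Rn n)} (hK : MeasurableSet K)
    (hKb : Bornology.IsBounded K) (hA : MeasurableSet A) : μ.onSet K A = μ.toFun (A ∩ K) := by
  classical
  rw [onSet, dif_pos ⟨hK, hKb⟩]
  exact if_pos hA

theorem onBall_apply (μ : LocVectorMeasure n) {R : ℝ} {A : Set (Rn n)} (hA : MeasurableSet A) :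
    μ.onBall R A = μ.toFun (A ∩ Metric.ball 0 R) :=
  μ.onSet_apply measurableSet_ball Metric.isBounded_ball hA

open scoped Classical in
/-- The locally finite vector measure with density `σ` with respect to a positive measure `m`. -/
def ofDensity (m : Measure (Rn n)) (σ : Rn n → Rn n)
    (hσ : ∀ R : ℝ, IntegrableOn σ (Metric.ball 0 R) m) : LocVectorMeasure n where
  toFun A := if MeasurableSet A ∧ Bornology.IsBounded A then ∫ x in A, σ x ∂m else 0
  eq_zero A hA := if_neg hA
  hasSum_iUnion A hA hd hb := by
    rw [if_pos ⟨MeasurableSet.iUnion hA, hb⟩]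
    have h (i) : MeasurableSet (A i) ∧ Bornology.IsBounded (A i) :=
      ⟨hA i, hb.subset (subset_iUnion A i)⟩
    simp only [h, and_self, if_true]
    obtain ⟨R, hR⟩ := hb.subset_ball 0
    exact hasSum_integral_iUnion hA hd ((hσ R).mono_set hR)

variable {m : Measure (Rn n)} {σ : Rn n → Rn n} {hσ : ∀ R : ℝ, IntegrableOn σ (Metric.ball 0 R) m}

theorem ofDensity_apply {A : Set (Rn n)} (hA : MeasurableSet A) (hb : Bornology.IsBounded A) :
    (ofDensity m σ hσ).toFun A = ∫ x in A, σ x ∂m := if_pos ⟨hA, hb⟩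

theorem integrableOn_of_isBounded (hσ : ∀ R : ℝ, IntegrableOn σ (Metric.ball 0 R) m)
    {A : Set (Rn n)} (hb : Bornology.IsBounded A) : IntegrableOn σ A m := by
  obtain ⟨R, hR⟩ := hb.subset_ball 0
  exact (hσ R).mono_set hR

theorem onSet_ofDensity {A : Set (Rn n)} (hA : MeasurableSet A) (hb : Bornology.IsBounded A) :
    (ofDensity m σ hσ).onSet A = (m.restrict A).withDensityᵥ σ := by
  ext B hB : 1
  rw [onSet_apply _ hA hb hB, ofDensity_apply (hB.inter hA) (hb.subset inter_subset_right),
    withDensityᵥ_apply (integrableOn_of_isBounded hσ hb) hB, Measure.restrict_restrict hB]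

theorem onBall_ofDensity (R : ℝ) :
    (ofDensity m σ hσ).onBall R = (m.restrict (Metric.ball 0 R)).withDensityᵥ σ :=
  onSet_ofDensity measurableSet_ball Metric.isBounded_ball

/-- The supremum of the variations on balls is at most their sum, and each of them has a density
with respect to $m$. This transfers $m$-a.e. statements to the variation measure. -/
theorem variation_ofDensity_absolutelyContinuous : (ofDensity m σ hσ).variation ≪ m := by
  have h : (ofDensity m σ hσ).variation ≤
      Measure.sum fun k : ℕ => ((ofDensity m σ hσ).onBall k).variation :=
    iSup_le fun k => Measure.le_sum _ k
  refine h.absolutelyContinuous.trans (Measure.absolutelyContinuous_sum_left fun k => ?_)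
  rw [onBall_ofDensity]
  exact (absolutelyContinuous_variation_withDensityᵥ (hσ k)).trans
    Measure.restrict_le_self.absolutelyContinuous

/-- On each ball the variation is $|\sigma|m$, and monotone convergence along the balls bounds
$\int|\sigma|\,dm$ by the total mass. -/
theorem integrable_of_variation_lt_top (hσm : AEStronglyMeasurable σ m)
    (h : (ofDensity m σ hσ).variation univ < ⊤) : Integrable σ m := by
  refine ⟨hσm, lt_of_le_of_lt ?_ h⟩
  have hU : (⋃ k : ℕ, Metric.ball (0 : Rn n) k) = univ := Metric.iUnion_ball_nat 0
  have hmono : Monotone fun k : ℕ => Metric.ball (0 : Rn n) k := fun i j hij =>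
    Metric.ball_subset_ball (by exact_mod_cast hij)
  rw [← setLIntegral_univ, ← hU, setLIntegral_iUnion_of_directed _ hmono.directed_le]
  refine iSup_le fun k => ?_
  have : ((ofDensity m σ hσ).onBall k).variation univ ≤ (ofDensity m σ hσ).variation univ :=
    (le_iSup (fun k : ℕ => ((ofDensity m σ hσ).onBall k).variation) k) univ
  rw [onBall_ofDensity, Measure.variation_withDensityᵥ (hσ k),
    withDensity_apply _ MeasurableSet.univ, Measure.restrict_univ] at this
  rwa [hU]

theorem integral_dotL_onBall_ofDensity {φ : Rn n → Rn n} (hφ : Continuous φ)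
    (hc : HasCompactSupport φ) {R : ℝ} (hR : tsupport φ ⊆ Metric.ball 0 R) :
    ((ofDensity m σ hσ).onBall R).integral φ (dotL n) = ∫ x, inner ℝ (φ x) (σ x) ∂m := by
  obtain ⟨C, hC⟩ := hφ.bounded_above_of_compact_support hc
  rw [onBall_ofDensity, vectorIntegral_withDensityᵥ _ (hσ R)
    (integrable_withDensity_enorm_of_bound (hσ R) hφ.aestronglyMeasurable hC)]
  refine setIntegral_eq_integral_of_forall_compl_eq_zero fun x hx => ?_
  have : φ x = 0 := image_eq_zero_of_notMem_tsupport fun h => hx (hR h)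
  simp [this]

theorem eqDensity_ofDensity {h : Rn n → ℝ} (hm : AEStronglyMeasurable h m) {C : ℝ}
    (hC : ∀ x, |h x| ≤ C) (hτ : ∀ R : ℝ, IntegrableOn (fun x => h x • σ x) (Metric.ball 0 R) m) :
    (ofDensity m (fun x => h x • σ x) hτ).EqDensity h (ofDensity m σ hσ) := by
  intro A hA hb
  have hi := integrableOn_of_isBounded hσ hb
  have := integrable_withDensity_enorm_of_bound hi hm.restrict hC
  rw [onSet_ofDensity hA hb, vectorIntegral_withDensityᵥ _ hi this, ofDensity_apply hA hb]
  refine ⟨?_, rfl⟩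
  rwa [VectorMeasure.Integrable, Measure.variation_withDensityᵥ hi]

end LocVectorMeasure

/-! ### Test fields determine a vector measure -/

theorem dotL_apply {n : ℕ} (x y : Rn n) : dotL n x y = inner ℝ x y := rfl

/-- Give both measures densities with respect to a common finite measure and test with $g\,e_i$, $g$
a scalar bump: the fundamental lemma of the calculus of variations identifies the densities a.e. on
the ball. -/
theorem vectorMeasure_apply_eq_of_integral_test_eq {n : ℕ} {V W : VectorMeasure (Rn n) (Rn n)}
    {R : ℝ} (h : ∀ φ : Rn n → Rn n, IsTest φ → tsupport φ ⊆ Metric.ball 0 R →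
      V.integral φ (dotL n) = W.integral φ (dotL n)) {A : Set (Rn n)} (hA : MeasurableSet A)
    (hAR : A ⊆ Metric.ball 0 R) : V A = W A := by
  obtain ⟨m, _, σ, τ, hσ, hτ, rfl, rfl⟩ := exists_common_density V W
  have key : ∀ᵐ x ∂m, x ∈ Metric.ball (0 : Rn n) R → σ x - τ x = 0 := by
    have hi (i : Fin n) : ∀ᵐ x ∂m, x ∈ Metric.ball (0 : Rn n) R → (σ x - τ x) i = 0 := by
      have hint : Integrable (fun x => (σ x - τ x) i) m :=
        (EuclideanSpace.proj (𝕜 := ℝ) i).integrable_comp (hσ.sub hτ)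
      refine Metric.isOpen_ball.ae_eq_zero_of_integral_contDiff_smul_eq_zero
        (hint.locallyIntegrable.locallyIntegrableOn _) fun g hg hgc hgR => ?_
      let φ : Rn n → Rn n := fun x => g x • EuclideanSpace.single i (1 : ℝ)
      have hφ : IsTest φ := ⟨hg.smul contDiff_const, hgc.smul_right⟩
      have hφR : tsupport φ ⊆ Metric.ball 0 R :=
        (closure_mono (Function.support_smul_subset_left _ _)).trans hgR
      have h1 := h φ hφ hφR
      obtain ⟨C, hC⟩ := hφ.1.continuous.bounded_above_of_compact_support hφ.2
      have b1 := integrable_withDensity_enorm_of_bound hσ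
        (hφ.1.continuous.aestronglyMeasurable (μ := m)) hC
      have b2 := integrable_withDensity_enorm_of_bound hτ
        (hφ.1.continuous.aestronglyMeasurable (μ := m)) hC
      rw [vectorIntegral_withDensityᵥ _ hσ b1, vectorIntegral_withDensityᵥ _ hτ b2,
        ← sub_eq_zero, ← integral_sub (integrable_apply_apply_withDensity _ hσ b1)
          (integrable_apply_apply_withDensity _ hτ b2)] at h1
      rw [← h1]
      congr 1 with x
      simp [φ, dotL_apply, EuclideanSpace.inner_single_left, mul_sub]
    filter_upwards [ae_all_iff.2 hi] with x hx hxR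
    ext i
    exact hx i hxR
  rw [withDensityᵥ_apply hσ hA, withDensityᵥ_apply hτ hA]
  refine setIntegral_congr_ae hA ?_
  filter_upwards [key] with x hx hxA
  exact sub_eq_zero.1 (hx (hAR hxA))

theorem locVectorMeasure_eq_of_integral_test_eq {n : ℕ} {D D' : LocVectorMeasure n}
    (h : ∀ φ : Rn n → Rn n, IsTest φ → ∀ R : ℝ, tsupport φ ⊆ Metric.ball 0 R →
      (D.onBall R).integral φ (dotL n) = (D'.onBall R).integral φ (dotL n)) : D = D' := by
  ext1 A hA hb
  obtain ⟨R, hR⟩ := hb.subset_ball 0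
  have := vectorMeasure_apply_eq_of_integral_test_eq (fun φ hφ hφR => h φ hφ R hφR) hA hR
  rwa [D.onBall_apply hA, D'.onBall_apply hA, inter_eq_left.2 hR] at this

/-! ### The fractional kernel -/

section Kernel

variable {n : ℕ} {α : ℝ}

/-- The kernel `z / |z|^{n + α + 1}`. -/
def kernel (n : ℕ) (α : ℝ) (z : Rn n) : Rn n := (‖z‖ ^ ((n : ℝ) + α + 1))⁻¹ • z

theorem inner_kernel (a z : Rn n) :
    inner ℝ a (kernel n α z) = inner ℝ a z / ‖z‖ ^ ((n : ℝ) + α + 1) := by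
  rw [kernel, inner_smul_right, div_eq_inv_mul]

theorem kernel_neg (z : Rn n) : kernel n α (-z) = -kernel n α z := by
  simp [kernel]

theorem measurable_kernel : Measurable (kernel n α) := by
  unfold kernel
  fun_prop

theorem norm_kernel (z : Rn n) : ‖kernel n α z‖ = (‖z‖ ^ ((n : ℝ) + α + 1))⁻¹ * ‖z‖ := by
  rw [kernel, norm_smul, Real.norm_of_nonneg (by positivity)]

/-- In polar coordinates the integrand is $\min(r,1)\,r^{-\alpha-1}$: integrable at $0$ because
$\alpha<1$, at infinity because $\alpha>0$. -/
theorem integrable_min_norm_mul_kernel (hn : 1 ≤ n) (hα0 : 0 < α) (hα1 : α < 1) :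
    Integrable (fun z : Rn n => min ‖z‖ 1 * ‖kernel n α z‖) := by
  have : Nontrivial (Rn n) := by
    have : Nonempty (Fin n) := ⟨⟨0, hn⟩⟩
    infer_instance
  simp only [norm_kernel]
  refine (integrable_fun_norm_addHaar (volume : Measure (Rn n))
    (f := fun r : ℝ => min r 1 * ((r ^ ((n : ℝ) + α + 1))⁻¹ * r))).2 ?_
  have hdim : Module.finrank ℝ (Rn n) = n := by simp
  rw [hdim]
  have key : ∀ r : ℝ, 0 < r → r ^ (n - 1) • (min r 1 * ((r ^ ((n : ℝ) + α + 1))⁻¹ * r)) =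
      min r 1 * r ^ (-α - 1) := by
    intro r hr
    have h1 : r ^ (n - 1) = r ^ ((n : ℝ) - 1) := by
      rw [← Real.rpow_natCast, Nat.cast_sub hn, Nat.cast_one]
    rw [h1, smul_eq_mul, ← Real.rpow_neg hr.le]
    have h2 : r ^ (-α - 1) = r ^ ((n : ℝ) - 1) * (r ^ (-((n : ℝ) + α + 1)) * r) := by
      conv_rhs => rw [← Real.rpow_add_one hr.ne', ← Real.rpow_add hr]
      congr 1
      ring
    rw [h2]
    ring
  rw [← Ioc_union_Ioi_eq_Ioi (zero_le_one (α := ℝ))]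
  refine IntegrableOn.union ?_ ?_
  · refine IntegrableOn.congr_fun (f := fun r : ℝ => r ^ (-α)) ?_ ?_ measurableSet_Ioc
    · exact (intervalIntegrable_iff_integrableOn_Ioc_of_le zero_le_one).1
        (intervalIntegral.intervalIntegrable_rpow' (by linarith))
    · intro r hr
      simp only
      rw [key r hr.1, min_eq_left hr.2, mul_comm, ← Real.rpow_add_one hr.1.ne']
      congr 1
      ring
  · refine IntegrableOn.congr_fun (f := fun r : ℝ => r ^ (-α - 1)) ?_ ?_ measurableSet_Ioi
    · exact integrableOn_Ioi_rpow_of_lt (by linarith) zero_lt_one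
    · intro r hr
      have hr' : (1 : ℝ) < r := hr
      simp only
      rw [key r (by linarith), min_eq_right hr'.le, one_mul]

variable {F : Type*} [NormedAddCommGroup F]

/-- The regularity that makes differences integrable against the kernel. -/
def BoundedLipschitz (C : ℝ) (ψ : Rn n → F) : Prop :=
  Continuous ψ ∧ ∀ x y, ‖ψ y - ψ x‖ ≤ C * min ‖y - x‖ 1

theorem BoundedLipschitz.integrable {C : ℝ} {ψ : Rn n → F} (hψ : BoundedLipschitz C ψ)
    (hn : 1 ≤ n) (hα0 : 0 < α) (hα1 : α < 1) (x : Rn n) :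
    Integrable (fun y => ‖ψ y - ψ x‖ * ‖kernel n α (y - x)‖) := by
  have h1 := ((integrable_min_norm_mul_kernel hn hα0 hα1).const_mul C).comp_sub_right x
  refine h1.mono' ?_ (Eventually.of_forall fun y => ?_)
  · have : Measurable fun y => kernel n α (y - x) :=
      measurable_kernel.comp (measurable_id.sub_const x)
    exact ((hψ.1.sub continuous_const).norm.aestronglyMeasurable).mul
      this.norm.aestronglyMeasurable
  · rw [Real.norm_of_nonneg (by positivity), ← mul_assoc]
    exact mul_le_mul_of_nonneg_right (hψ.2 x y) (norm_nonneg _)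

theorem aestronglyMeasurable_diff_kernel {ψ : Rn n → F} (hψ : Continuous ψ) :
    AEStronglyMeasurable (fun p : Rn n × Rn n => ‖ψ p.2 - ψ p.1‖ * ‖kernel n α (p.2 - p.1)‖)
      (volume.prod volume) := by
  have : Measurable fun p : Rn n × Rn n => kernel n α (p.2 - p.1) :=
    measurable_kernel.comp (measurable_snd.sub measurable_fst)
  refine AEStronglyMeasurable.mul ?_ this.norm.aestronglyMeasurable
  exact (((hψ.comp continuous_snd).sub (hψ.comp continuous_fst)).norm).aestronglyMeasurable

/-- The measure-preserving shear $(x,y)\mapsto(x,y-x)$ separates the variables. -/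
theorem integrable_mul_min_norm_mul_kernel_prod (hn : 1 ≤ n) (hα0 : 0 < α) (hα1 : α < 1)
    {f : Rn n → ℝ} (hf : Integrable f) (C : ℝ) :
    Integrable (fun p : Rn n × Rn n =>
      |f p.1| * (C * (min ‖p.2 - p.1‖ 1 * ‖kernel n α (p.2 - p.1)‖))) (volume.prod volume) := by
  have h1 : Integrable (fun p : Rn n × Rn n =>
      |f p.1| * (C * (min ‖p.2‖ 1 * ‖kernel n α p.2‖))) (volume.prod volume) :=
    hf.abs.mul_prod ((integrable_min_norm_mul_kernel hn hα0 hα1).const_mul C)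
  have hmp : MeasurePreserving (fun p : Rn n × Rn n => (p.1, -p.1 + p.2))
      (volume.prod volume) (volume.prod volume) := measurePreserving_prod_neg_add _ _
  simpa only [Function.comp_def, neg_add_eq_sub] using (hmp.integrable_comp h1.1).2 h1

theorem BoundedLipschitz.integrable_mul_prod {C : ℝ} {ψ : Rn n → F} (hψ : BoundedLipschitz C ψ)
    (hn : 1 ≤ n) (hα0 : 0 < α) (hα1 : α < 1) {f : Rn n → ℝ} (hf : Integrable f) :
    Integrable (fun p : Rn n × Rn n => |f p.1| * (‖ψ p.2 - ψ p.1‖ * ‖kernel n α (p.2 - p.1)‖))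
      (volume.prod volume) := by
  refine (integrable_mul_min_norm_mul_kernel_prod hn hα0 hα1 hf C).mono'
    (hf.abs.1.comp_fst.mul (aestronglyMeasurable_diff_kernel hψ.1))
    (Eventually.of_forall fun p => ?_)
  rw [Real.norm_of_nonneg (by positivity)]
  rw [← mul_assoc C]
  gcongr
  exact hψ.2 _ _

/-- The difference vanishes unless one of the two points lies in the support. The weighted bound for
the indicator of the support, added to its reflection, therefore dominates. This justifies Fubini
when $f$ is merely bounded. -/
theorem BoundedLipschitz.integrable_prod {C : ℝ} {ψ : Rn n → F} (hψ : BoundedLipschitz C ψ)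
    (hc : HasCompactSupport ψ) (hn : 1 ≤ n) (hα0 : 0 < α) (hα1 : α < 1) :
    Integrable (fun p : Rn n × Rn n => ‖ψ p.2 - ψ p.1‖ * ‖kernel n α (p.2 - p.1)‖)
      (volume.prod volume) := by
  let S := tsupport ψ
  have hS : Integrable (S.indicator fun _ => (1 : ℝ)) (volume : Measure (Rn n)) :=
    (integrable_indicator_iff hc.measurableSet).2 (integrableOn_const hc.measure_lt_top.ne)
  have h1 := hψ.integrable_mul_prod hn hα0 hα1 hS
  have h2 := h1.swap
  refine (h1.add h2).mono' (aestronglyMeasurable_diff_kernel hψ.1)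
    (Eventually.of_forall fun p => ?_)
  rw [Real.norm_of_nonneg (by positivity)]
  simp only [Pi.add_apply, Function.comp_apply, Prod.fst_swap, Prod.snd_swap]
  rw [norm_sub_rev (ψ p.1), ← neg_sub p.2 p.1, kernel_neg, norm_neg, ← add_mul]
  have hnn : 0 ≤ ‖ψ p.2 - ψ p.1‖ * ‖kernel n α (p.2 - p.1)‖ := by positivity
  by_cases hp1 : p.1 ∈ S
  · rw [indicator_of_mem hp1, abs_one]
    nlinarith [abs_nonneg (S.indicator (fun _ => (1 : ℝ)) p.2)]
  · by_cases hp2 : p.2 ∈ S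
    · rw [indicator_of_mem hp2, abs_one]
      nlinarith [abs_nonneg (S.indicator (fun _ => (1 : ℝ)) p.1)]
    · rw [image_eq_zero_of_notMem_tsupport hp1, image_eq_zero_of_notMem_tsupport hp2]
      simp

theorem exists_boundedLipschitz [NormedSpace ℝ F] {ψ : Rn n → F} (hψ : ContDiff ℝ ∞ ψ)
    (hc : HasCompactSupport ψ) : ∃ C, 0 ≤ C ∧ BoundedLipschitz C ψ := by
  obtain ⟨M, hM⟩ := hψ.continuous.bounded_above_of_compact_support hc
  obtain ⟨L, hL⟩ := ContDiff.lipschitzWith_of_hasCompactSupport hc hψ (by simp)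
  have hM0 : 0 ≤ M := (norm_nonneg _).trans (hM 0)
  refine ⟨L + 2 * M, by positivity, hψ.continuous, fun x y => ?_⟩
  have h1 : ‖ψ y - ψ x‖ ≤ L * ‖y - x‖ := by simpa [dist_eq_norm] using hL.dist_le_mul y x
  have h2 : ‖ψ y - ψ x‖ ≤ 2 * M := (norm_sub_le _ _).trans (by linarith [hM y, hM x])
  rcases le_total ‖y - x‖ 1 with h | h
  · rw [min_eq_left h]; nlinarith [norm_nonneg (y - x)]
  · rw [min_eq_right h]; nlinarith [L.2]

end Kernel

/-! ### Mollification -/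

section Mollify

variable {n : ℕ}

/-- A smooth even mollifier supported in the ball of radius `ε`. -/
structure IsMollifier (ρ : Rn n → ℝ) (ε : ℝ) : Prop where
  pos : 0 < ε
  contDiff : ContDiff ℝ ∞ ρ
  nonneg : ∀ x, 0 ≤ ρ x
  neg : ∀ x, ρ (-x) = ρ x
  eq_zero : ∀ x, ε ≤ ‖x‖ → ρ x = 0
  integral : ∫ x, ρ x = 1

variable {F : Type*} [NormedAddCommGroup F] [NormedSpace ℝ F] [CompleteSpace F]

/-- The mollification `x ↦ ∫ ρ(x - z) f(z) dz`. -/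
def mollify (ρ : Rn n → ℝ) (f : Rn n → F) (x : Rn n) : F := ∫ z, ρ (x - z) • f z

variable {ρ : Rn n → ℝ} {ε : ℝ}

namespace IsMollifier

theorem hasCompactSupport (hρ : IsMollifier ρ ε) : HasCompactSupport ρ :=
  HasCompactSupport.intro (isCompact_closedBall 0 ε) fun x hx =>
    hρ.eq_zero x (by simpa using (not_le.1 (by simpa using hx)).le)

theorem integrable (hρ : IsMollifier ρ ε) : Integrable ρ :=
  hρ.contDiff.continuous.integrable_of_hasCompactSupport hρ.hasCompactSupport

theorem integral_translate (hρ : IsMollifier ρ ε) (x : Rn n) : ∫ z, ρ (x - z) = 1 := by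
  rw [integral_sub_left_eq_self ρ volume x, hρ.integral]

theorem integrable_sub (hρ : IsMollifier ρ ε) (x : Rn n) : Integrable fun z => ρ (x - z) :=
  hρ.integrable.comp_sub_left x

omit [CompleteSpace F] in
theorem integrable_smul (hρ : IsMollifier ρ ε) {f : Rn n → F} {M : ℝ}
    (hf : AEStronglyMeasurable f) (hM : ∀ x, ‖f x‖ ≤ M) (x : Rn n) :
    Integrable fun z => ρ (x - z) • f z := by
  refine ((hρ.integrable_sub x).norm.mul_const M).mono' ((hρ.integrable_sub x).1.smul hf)
    (Eventually.of_forall fun z => ?_)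
  rw [norm_smul]
  exact mul_le_mul_of_nonneg_left (hM z) (norm_nonneg _)

omit [CompleteSpace F] in
theorem contDiff_mollify (hρ : IsMollifier ρ ε) {f : Rn n → F} {M : ℝ}
    (hf : AEStronglyMeasurable f) (hM : ∀ x, ‖f x‖ ≤ M) : ContDiff ℝ ∞ (mollify ρ f) := by
  have hloc : LocallyIntegrable f (volume : Measure (Rn n)) :=
    (memLp_top_of_bound hf M (Eventually.of_forall hM)).locallyIntegrable le_top
  exact hρ.hasCompactSupport.contDiff_convolution_right
    (ContinuousLinearMap.lsmul ℝ ℝ : ℝ →L[ℝ] F →L[ℝ] F).flip hloc hρ.contDiff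

/-- The error is an average of $f-v$ over the $\varepsilon$-ball. The choice $v=0$ gives the sup
bound, and $v$ the value at $x$ gives uniform convergence. -/
theorem norm_mollify_sub_le (hρ : IsMollifier ρ ε) {f : Rn n → F} {M δ : ℝ}
    (hf : AEStronglyMeasurable f) (hM : ∀ x, ‖f x‖ ≤ M) {x : Rn n} {v : F}
    (hv : ∀ z, ‖x - z‖ < ε → ‖f z - v‖ ≤ δ) : ‖mollify ρ f x - v‖ ≤ δ := by
  have h1 : mollify ρ f x - v = ∫ z, ρ (x - z) • (f z - v) := by
    simp only [smul_sub]
    rw [integral_sub (hρ.integrable_smul hf hM x)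
      ((hρ.integrable_sub x).smul_const v), integral_smul_const, hρ.integral_translate, one_smul,
      mollify]
  rw [h1]
  refine (norm_integral_le_of_norm_le ((hρ.integrable_sub x).mul_const δ)
    (Eventually.of_forall fun z => ?_)).trans (le_of_eq ?_)
  · rw [norm_smul, Real.norm_of_nonneg (hρ.nonneg _)]
    by_cases h : ‖x - z‖ < ε
    · exact mul_le_mul_of_nonneg_left (hv z h) (hρ.nonneg _)
    · rw [hρ.eq_zero _ (not_lt.1 h)]; simp
  · rw [integral_mul_const, hρ.integral_translate, one_mul]

theorem norm_mollify_le (hρ : IsMollifier ρ ε) {f : Rn n → F} {M : ℝ}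
    (hf : AEStronglyMeasurable f) (hM : ∀ x, ‖f x‖ ≤ M) (x : Rn n) : ‖mollify ρ f x‖ ≤ M := by
  simpa using hρ.norm_mollify_sub_le hf hM (x := x) (v := 0) fun z _ => by simpa using hM z

theorem mollify_nonneg (hρ : IsMollifier ρ ε) {f : Rn n → ℝ} (hf : ∀ x, 0 ≤ f x) (x : Rn n) :
    0 ≤ mollify ρ f x :=
  integral_nonneg fun z => mul_nonneg (hρ.nonneg _) (hf z)

omit [CompleteSpace F] in
theorem tsupport_mollify_subset (hρ : IsMollifier ρ ε) {f : Rn n → F} {R R' : ℝ}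
    (hf : ∀ x, R ≤ ‖x‖ → f x = 0) (hR : R + ε < R') :
    tsupport (mollify ρ f) ⊆ Metric.ball 0 R' := by
  have h1 : Function.support (mollify ρ f) ⊆ Metric.closedBall 0 (R + ε) := by
    intro x hx
    by_contra hx'
    refine hx ?_
    have hx2 : R + ε < ‖x‖ := by simpa using hx'
    refine integral_eq_zero_of_ae (Eventually.of_forall fun z => ?_)
    by_cases h : R ≤ ‖z‖
    · simp [hf z h]
    · have : ε ≤ ‖x - z‖ := by
        have := norm_sub_norm_le x z
        push Not at h
        linarith
      simp [hρ.eq_zero _ this]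
  exact (closure_minimal h1 Metric.isClosed_closedBall).trans (Metric.closedBall_subset_ball hR)

theorem isTest_mollify (hρ : IsMollifier ρ ε) {f : Rn n → Rn n} {M R : ℝ}
    (hf : AEStronglyMeasurable f) (hM : ∀ x, ‖f x‖ ≤ M) (hR : ∀ x, R ≤ ‖x‖ → f x = 0) :
    IsTest (mollify ρ f) := by
  refine ⟨hρ.contDiff_mollify hf hM, ?_⟩
  exact (isCompact_closedBall (0 : Rn n) (R + ε + 1)).of_isClosed_subset (isClosed_tsupport _)
    ((hρ.tsupport_mollify_subset hR (lt_add_one _)).trans Metric.ball_subset_closedBall)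

/-- With $x$ frozen, the commutator is the mollification of $z\mapsto f(z)(\varphi(z)-\varphi(x))$,
so only the oscillation of $\varphi$ matters and no regularity of $f$ is needed. -/
theorem norm_mollify_smul_sub_le (hρ : IsMollifier ρ ε) {f : Rn n → ℝ} {φ : Rn n → F}
    {M C : ℝ} (hf : AEStronglyMeasurable f) (hf1 : ∀ x, ‖f x‖ ≤ 1)
    (hφ : BoundedLipschitz C φ) (hC : 0 ≤ C) (hM : ∀ x, ‖φ x‖ ≤ M) (x : Rn n) :
    ‖mollify ρ (fun z => f z • φ z) x - mollify ρ f x • φ x‖ ≤ C * ε := by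
  have h1 : mollify ρ (fun z => f z • φ z) x - mollify ρ f x • φ x =
      mollify ρ (fun z => f z • (φ z - φ x)) x := by
    have i1 : Integrable fun z => ρ (x - z) • f z • φ z := by
      refine hρ.integrable_smul (M := M) (hf.smul hφ.1.aestronglyMeasurable) (fun z => ?_) x
      rw [Pi.smul_apply', norm_smul]
      nlinarith [hf1 z, hM z, norm_nonneg (φ z), norm_nonneg (f z)]
    have i2 : Integrable fun z => (ρ (x - z) • f z) • φ x :=
      (hρ.integrable_smul hf hf1 x).smul_const _
    simp only [mollify]
    rw [← integral_smul_const, ← integral_sub i1 i2]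
    congr 1 with z
    rw [smul_sub, smul_sub, smul_assoc]
  rw [h1, ← sub_zero (mollify _ _ _)]
  have hb : ∀ z, ‖f z • (φ z - φ x)‖ ≤ ‖φ z - φ x‖ := fun z => by
    rw [norm_smul]
    nlinarith [hf1 z, norm_nonneg (φ z - φ x)]
  refine hρ.norm_mollify_sub_le (M := C)
    (hf.smul (hφ.1.sub continuous_const).aestronglyMeasurable) (fun z => ?_) fun z hz => ?_
  · refine (hb z).trans ((hφ.2 x z).trans ?_)
    nlinarith [min_le_right ‖z - x‖ 1]
  · rw [sub_zero]
    refine (hb z).trans ((hφ.2 x z).trans ?_)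
    have : min ‖z - x‖ 1 ≤ ε := (min_le_left _ _).trans (by rw [norm_sub_rev]; exact hz.le)
    gcongr

theorem norm_mollify_sub_self_le (hρ : IsMollifier ρ ε) {φ : Rn n → F}
    {M C : ℝ} (hφ : BoundedLipschitz C φ) (hC : 0 ≤ C) (hM : ∀ x, ‖φ x‖ ≤ M) (x : Rn n) :
    ‖mollify ρ φ x - φ x‖ ≤ C * ε := by
  refine hρ.norm_mollify_sub_le hφ.1.aestronglyMeasurable hM fun z hz => (hφ.2 x z).trans ?_
  have : min ‖z - x‖ 1 ≤ ε := (min_le_left _ _).trans (by rw [norm_sub_rev]; exact hz.le)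
  gcongr

end IsMollifier

/-! #### A radially decreasing mollifier -/

/-- A smooth radially decreasing bump supported in the ball of radius `ε`. -/
def radialBump (n : ℕ) (ε : ℝ) (x : Rn n) : ℝ := Real.smoothTransition (1 - ‖x‖ ^ 2 / ε ^ 2)

/-- The normalized radial bump. -/
def radialMollifier (n : ℕ) (ε : ℝ) (x : Rn n) : ℝ :=
  (∫ y, radialBump n ε y)⁻¹ * radialBump n ε x

theorem contDiff_radialBump (n : ℕ) (ε : ℝ) : ContDiff ℝ ∞ (radialBump n ε) :=
  Real.smoothTransition.contDiff.comp (contDiff_const.sub ((contDiff_norm_sq ℝ).div_const _))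

theorem radialBump_eq_zero {ε : ℝ} (hε : 0 < ε) {x : Rn n} (hx : ε ≤ ‖x‖) :
    radialBump n ε x = 0 := by
  refine Real.smoothTransition.zero_of_nonpos ?_
  rw [sub_nonpos, le_div_iff₀ (by positivity)]
  nlinarith

theorem hasCompactSupport_radialBump {ε : ℝ} (hε : 0 < ε) : HasCompactSupport (radialBump n ε) :=
  HasCompactSupport.intro (isCompact_closedBall 0 ε) fun x hx =>
    radialBump_eq_zero hε (not_le.1 (by simpa using hx)).le

theorem integral_radialBump_pos {ε : ℝ} (hε : 0 < ε) : 0 < ∫ y, radialBump n ε y := by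
  refine (contDiff_radialBump n ε).continuous.integral_pos_of_hasCompactSupport_nonneg_nonzero
    (hasCompactSupport_radialBump hε) (fun x => Real.smoothTransition.nonneg _) (x := 0) ?_
  simp [radialBump]

theorem isMollifier_radialMollifier {ε : ℝ} (hε : 0 < ε) : IsMollifier (radialMollifier n ε) ε where
  pos := hε
  contDiff := contDiff_const.mul (contDiff_radialBump n ε)
  nonneg x := mul_nonneg (inv_nonneg.2 (integral_radialBump_pos hε).le)
    (Real.smoothTransition.nonneg _)
  neg x := by simp [radialMollifier, radialBump]
  eq_zero x hx := by rw [radialMollifier, radialBump_eq_zero hε hx, mul_zero]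
  integral := by
    simp only [radialMollifier]
    rw [integral_const_mul, inv_mul_cancel₀ (integral_radialBump_pos hε).ne']

/-- The profile is monotone in $\|x\|$. This is what will compare mollification with averages over
balls. -/
theorem exists_superlevel_radialBump_eq_ball {ε : ℝ} (hε : 0 < ε) {s : ℝ} (hs : 0 ≤ s) :
    ∃ r ≤ ε, ∀ x : Rn n, s < radialBump n ε x ↔ ‖x‖ < r := by
  let T := {u : ℝ | s < Real.smoothTransition u}
  have hT0 : ∀ u ∈ T, 0 < u := fun u hu => by
    by_contra h
    have : s < 0 := by
      have hu' : s < Real.smoothTransition u := hu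
      rwa [Real.smoothTransition.zero_of_nonpos (not_lt.1 h)] at hu'
    linarith
  rcases T.eq_empty_or_nonempty with hT | hT
  · refine ⟨0, hε.le, fun x => ?_⟩
    have : (1 - ‖x‖ ^ 2 / ε ^ 2) ∉ T := by simp [hT]
    simp only [norm_nonneg, not_lt.2, iff_false]
    exact this
  · have hbdd : BddBelow T := ⟨0, fun u hu => (hT0 u hu).le⟩
    have hopen : IsOpen T := isOpen_lt continuous_const Real.smoothTransition.continuous
    -- An open upward-closed set of reals that is bounded below is an open ray.
    have hup : ∀ u, u ∈ T ↔ sInf T < u := by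
      intro u
      constructor
      · intro hu
        obtain ⟨δ, hδ, h⟩ := Metric.isOpen_iff.1 hopen u hu
        have h1 : u - δ / 2 ∈ T := h (by simp [abs_of_pos hδ]; linarith)
        have := csInf_le hbdd h1
        linarith
      · intro hu
        obtain ⟨t, ht, htu⟩ := (csInf_lt_iff hbdd hT).1 hu
        exact lt_of_lt_of_le ht (Real.smoothTransition.monotone htu.le)
    have ha : 0 ≤ sInf T := le_csInf hT fun u hu => (hT0 u hu).le
    -- The radius solves $1-r^2/\varepsilon^2=\inf T$. When $\inf T\ge1$ the square root is $0$ and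
    -- the ball is empty.
    refine ⟨√((1 - sInf T) * ε ^ 2), ?_, fun x => ?_⟩
    · rw [Real.sqrt_le_left hε.le]
      nlinarith [sq_nonneg ε]
    · rw [Real.lt_sqrt (norm_nonneg _), ← div_lt_iff₀ (by positivity)]
      refine (hup _).trans ?_
      constructor <;> intro h <;> linarith

/-- Layer cake: $b(x)=\int_0^1\mathbf 1_{s<b(x)}\,ds$, followed by Fubini. -/
theorem integral_mul_eq_integral_superlevel {X : Type*} [MeasurableSpace X] {μ : Measure X}
    [IsFiniteMeasure μ] {b g : X → ℝ} (hb : Measurable b) (hb0 : ∀ x, 0 ≤ b x)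
    (hb1 : ∀ x, b x ≤ 1) (hg : Integrable g μ) :
    IntegrableOn (fun s => ∫ x in {x | s < b x}, g x ∂μ) (Ioc (0 : ℝ) 1) ∧
    ∫ x, b x * g x ∂μ = ∫ s in Ioc (0 : ℝ) 1, ∫ x in {x | s < b x}, g x ∂μ := by
  let S : Set (X × ℝ) := {p | p.2 < b p.1}
  have hS : MeasurableSet S := measurableSet_lt measurable_snd (hb.comp measurable_fst)
  have hint : Integrable (S.indicator fun p : X × ℝ => g p.1)
      (μ.prod (volume.restrict (Ioc (0 : ℝ) 1))) :=
    (hg.comp_fst _).indicator hS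
  have h1 (s : ℝ) : ∫ x, S.indicator (fun p : X × ℝ => g p.1) (x, s) ∂μ =
      ∫ x in {x | s < b x}, g x ∂μ := by
    rw [← integral_indicator (measurableSet_lt measurable_const hb)]
    rfl
  have h2 (x : X) : ∫ s in Ioc (0 : ℝ) 1, S.indicator (fun p : X × ℝ => g p.1) (x, s) =
      b x * g x := by
    have : (fun s => S.indicator (fun p : X × ℝ => g p.1) (x, s)) =
        (Iio (b x)).indicator fun _ => g x := rfl
    rw [this, setIntegral_indicator measurableSet_Iio, setIntegral_const, smul_eq_mul]
    congr 1
    rw [measureReal_def, measure_congr (Ioo_ae_eq_Ioc.symm.inter (ae_eq_refl (Iio (b x)))),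
      Ioo_inter_Iio, min_eq_right (hb1 x), Real.volume_Ioo, sub_zero,
      ENNReal.toReal_ofReal (hb0 x)]
  refine ⟨?_, ?_⟩
  · have := hint.integral_prod_right
    simpa only [h1, IntegrableOn] using this
  · simp only [← h1, ← h2]
    exact integral_integral_swap hint

/-- By the layer-cake formula the mollification is a superposition of integrals over balls centred
at $x$ of radius at most $\varepsilon$, so control of ball averages suffices. The point $x$ need not
be a Lebesgue point, which is why the mollifier has to be radially decreasing. -/
theorem tendsto_mollify_of_tendsto_average {f : Rn n → ℝ} (hf : AEStronglyMeasurable f)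
    (hf1 : ∀ x, ‖f x‖ ≤ 1) {x : Rn n} {l : ℝ}
    (hl : Tendsto (fun r : ℝ => ⨍ y in Metric.ball x r, f y) (𝓝[>] 0) (𝓝 l)) :
    Tendsto (fun ε => mollify (radialMollifier n ε) f x) (𝓝[>] 0) (𝓝 l) := by
  rw [Metric.tendsto_nhds] at hl ⊢
  intro δ hδ
  obtain ⟨r₀, hr₀, h⟩ := (mem_nhdsGT_iff_exists_Ioo_subset).1 (hl (δ / 2) (half_pos hδ))
  have hr₀' : (0 : ℝ) < r₀ := hr₀
  filter_upwards [Ioo_mem_nhdsGT hr₀'] with ε hε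
  have hfi : ∀ r, IntegrableOn f (Metric.ball x r) := fun r =>
    ⟨hf.restrict, HasFiniteIntegral.restrict_of_bounded (C := 1) measure_ball_lt_top
      (Eventually.of_forall hf1)⟩
  -- The estimate is left unnormalized so that it also covers empty balls.
  have hball : ∀ r ≤ ε, |∫ z in Metric.ball x r, (f z - l)| ≤
      δ / 2 * ∫ z in Metric.ball x r, (1 : ℝ) := by
    intro r hr
    rcases le_or_gt r 0 with hr0 | hr0
    · simp [Metric.ball_eq_empty.2 hr0]
    · have := h ⟨hr0, lt_of_le_of_lt hr hε.2⟩
      simp only [mem_ofPred_eq, Real.dist_eq] at this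
      have hpos : 0 < volume.real (Metric.ball x r) :=
        ENNReal.toReal_pos (Metric.measure_ball_pos _ _ hr0).ne' measure_ball_lt_top.ne
      rw [integral_sub (hfi r) (integrableOn_const measure_ball_lt_top.ne), setIntegral_const,
        setIntegral_const, smul_eq_mul, smul_eq_mul, mul_one]
      rw [setAverage_eq, smul_eq_mul] at this
      have h3 : (∫ z in Metric.ball x r, f z) - volume.real (Metric.ball x r) * l =
          volume.real (Metric.ball x r) *
            ((volume.real (Metric.ball x r))⁻¹ * (∫ z in Metric.ball x r, f z) - l) := by
        field_simp
      rw [h3, abs_mul, abs_of_pos hpos, mul_comm]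
      exact mul_le_mul_of_nonneg_right this.le hpos.le
  have hρ := isMollifier_radialMollifier (n := n) hε.1
  let b : Rn n → ℝ := fun z => radialBump n ε (x - z)
  have hbm : Measurable b :=
    ((contDiff_radialBump n ε).continuous.measurable).comp (measurable_const.sub measurable_id)
  have hb0 : ∀ z, 0 ≤ b z := fun z => Real.smoothTransition.nonneg _
  have hb1 : ∀ z, b z ≤ 1 := fun z => Real.smoothTransition.le_one _
  let μ : Measure (Rn n) := volume.restrict (Metric.ball x ε)
  have hμ : IsFiniteMeasure μ := ⟨by simp [μ, measure_ball_lt_top]⟩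
  have hfull (g : Rn n → ℝ) : ∫ z, b z * g z = ∫ z, b z * g z ∂μ := by
    refine (setIntegral_eq_integral_of_forall_compl_eq_zero fun z hz => ?_).symm
    have : ε ≤ ‖x - z‖ := by simpa [dist_eq_norm, norm_sub_rev] using hz
    simp [b, radialBump_eq_zero hε.1 this]
  have hg : Integrable (fun z => f z - l) μ := (hfi ε).sub (integrable_const l)
  obtain ⟨i1, e1⟩ := integral_mul_eq_integral_superlevel hbm hb0 hb1 hg
  obtain ⟨i2, e2⟩ := integral_mul_eq_integral_superlevel hbm hb0 hb1
    (integrable_const (μ := μ) (1 : ℝ))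
  have hlevel : ∀ s ∈ Ioc (0 : ℝ) 1, |∫ z in {z | s < b z}, (f z - l) ∂μ| ≤
      δ / 2 * ∫ z in {z | s < b z}, (1 : ℝ) ∂μ := by
    intro s hs
    obtain ⟨r, hr, hrb⟩ := exists_superlevel_radialBump_eq_ball (n := n) hε.1 hs.1.le
    have hset : {z | s < b z} = Metric.ball x r := by
      ext z
      simp [b, hrb, dist_eq_norm, norm_sub_rev]
    rw [hset]
    simp only [μ]
    rw [Measure.restrict_restrict measurableSet_ball,
      inter_eq_left.2 (Metric.ball_subset_ball hr)]
    exact hball r hr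
  have hmain : |∫ z, b z * (f z - l)| ≤ δ / 2 * ∫ z, b z := by
    have e3 : ∫ z, b z = ∫ z, b z * 1 := by simp
    rw [e3, hfull, hfull, e1, e2, ← integral_const_mul]
    rw [← Real.norm_eq_abs]
    exact norm_integral_le_of_norm_le (i2.const_mul (δ / 2))
      ((ae_restrict_iff' measurableSet_Ioc).2 (Eventually.of_forall hlevel))
  have hbint : ∫ z, b z = ∫ z, radialBump n ε z :=
    integral_sub_left_eq_self (radialBump n ε) volume x
  have hpos := integral_radialBump_pos (n := n) hε.1
  have hrepr : mollify (radialMollifier n ε) f x - l =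
      (∫ z, radialBump n ε z)⁻¹ * ∫ z, b z * (f z - l) := by
    have : mollify (radialMollifier n ε) f x - l =
        ∫ z, radialMollifier n ε (x - z) * (f z - l) := by
      have i0 : Integrable fun z => radialMollifier n ε (x - z) * f z :=
        hρ.integrable_smul hf hf1 x
      simp only [mul_sub]
      rw [integral_sub i0 ((hρ.integrable_sub x).mul_const l),
        integral_mul_const, hρ.integral_translate, one_mul]
      rfl
    rw [this, ← integral_const_mul]
    congr 1 with z
    simp only [radialMollifier, b]
    ring
  rw [Real.dist_eq, hrepr, abs_mul, abs_of_pos (inv_pos.2 hpos)]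
  calc _ ≤ (∫ z, radialBump n ε z)⁻¹ * (δ / 2 * ∫ z, b z) := by gcongr
    _ = δ / 2 := by rw [hbint]; field_simp
    _ < δ := half_lt_self hδ

theorem closedBall_ae_eq_ball {x : Rn n} {r : ℝ} (hr : r ≠ 0) :
    Metric.closedBall x r =ᵐ[volume] Metric.ball x r := by
  refine (ae_eq_of_subset_of_measure_ge Metric.ball_subset_closedBall ?_
    measurableSet_ball.nullMeasurableSet measure_closedBall_lt_top.ne).symm
  rw [← Metric.ball_union_sphere]
  refine (measure_union_le _ _).trans ?_
  rw [Measure.addHaar_sphere_of_ne_zero volume x hr, add_zero]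

theorem ae_tendsto_average_ball {f : Rn n → ℝ} (hf : AEStronglyMeasurable f)
    (hf1 : ∀ x, ‖f x‖ ≤ 1) :
    ∀ᵐ x, Tendsto (fun r : ℝ => ⨍ y in Metric.ball x r, f y) (𝓝[>] 0) (𝓝 (f x)) := by
  have hloc : LocallyIntegrable f (volume : Measure (Rn n)) :=
    (memLp_top_of_bound hf 1 (Eventually.of_forall hf1)).locallyIntegrable le_top
  filter_upwards [IsUnifLocDoublingMeasure.ae_tendsto_average volume hloc 1] with x hx
  refine (hx (fun _ : ℝ => x) id tendsto_id ?_).congr' ?_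
  · filter_upwards [self_mem_nhdsWithin] with r hr
    simpa using (le_of_lt hr)
  · filter_upwards [self_mem_nhdsWithin] with r (hr : 0 < r)
    exact setAverage_congr (closedBall_ae_eq_ball hr.ne')

end Mollify

/-! ### Fractional operators and mollification -/

section Duality

variable {n : ℕ} {α : ℝ}

theorem fracDiv_eq (φ : Rn n → Rn n) (x : Rn n) :
    fracDiv α φ x = muConst n α * ∫ y, inner ℝ (φ y - φ x) (kernel n α (y - x)) := by
  simp only [fracDiv, inner_kernel]

theorem fracDivNL_eq (g : Rn n → ℝ) (φ : Rn n → Rn n) (x : Rn n) :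
    fracDivNL α g φ x =
      muConst n α * ∫ y, (g y - g x) * inner ℝ (φ y - φ x) (kernel n α (y - x)) := by
  simp only [fracDivNL, inner_kernel, mul_div_assoc]

theorem BoundedLipschitz.integrable_inner {C : ℝ} {φ : Rn n → Rn n} (hφ : BoundedLipschitz C φ)
    (hn : 1 ≤ n) (hα0 : 0 < α) (hα1 : α < 1) (x : Rn n) :
    Integrable (fun y => inner ℝ (φ y - φ x) (kernel n α (y - x))) := by
  refine (hφ.integrable hn hα0 hα1 x).mono' ?_ (Eventually.of_forall fun y =>
    norm_inner_le_norm _ _)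
  have : Measurable fun y => kernel n α (y - x) :=
    measurable_kernel.comp (measurable_id.sub_const x)
  exact (hφ.1.sub continuous_const).aestronglyMeasurable.inner this.aestronglyMeasurable

theorem aestronglyMeasurable_inner_diff_kernel {φ : Rn n → Rn n} (hφ : Continuous φ) :
    AEStronglyMeasurable
      (fun p : Rn n × Rn n => inner ℝ (φ p.2 - φ p.1) (kernel n α (p.2 - p.1)))
      (volume.prod volume) := by
  have : Measurable fun p : Rn n × Rn n => kernel n α (p.2 - p.1) :=
    measurable_kernel.comp (measurable_snd.sub measurable_fst)
  exact ((hφ.comp continuous_snd).sub (hφ.comp continuous_fst)).aestronglyMeasurable.inner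
    this.aestronglyMeasurable

theorem BoundedLipschitz.integrable_inner_prod {C : ℝ} {φ : Rn n → Rn n}
    (hφ : BoundedLipschitz C φ) (hc : HasCompactSupport φ) (hn : 1 ≤ n) (hα0 : 0 < α)
    (hα1 : α < 1) :
    Integrable (fun p : Rn n × Rn n => inner ℝ (φ p.2 - φ p.1) (kernel n α (p.2 - p.1)))
      (volume.prod volume) :=
  (hφ.integrable_prod hc hn hα0 hα1).mono' (aestronglyMeasurable_inner_diff_kernel hφ.1)
    (Eventually.of_forall fun _ => norm_inner_le_norm _ _)

theorem IsTest.integrable_fracDiv {φ : Rn n → Rn n} (hφ : IsTest φ) (hn : 1 ≤ n) (hα0 : 0 < α)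
    (hα1 : α < 1) : Integrable (fracDiv α φ) := by
  obtain ⟨C, _, hC⟩ := exists_boundedLipschitz hφ.1 hφ.2
  have := (hC.integrable_inner_prod hφ.2 hn hα0 hα1).integral_prod_left
  exact (this.const_mul (muConst n α)).congr (Eventually.of_forall fun x => (fracDiv_eq φ x).symm)

variable {f : Rn n → ℝ}

theorem integrable_bounded_mul (hf : AEStronglyMeasurable f) (hf1 : ∀ x, ‖f x‖ ≤ 1)
    {g : Rn n → ℝ} (hg : Integrable g) : Integrable fun x => f x * g x :=
  hg.bdd_mul hf (Eventually.of_forall hf1)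

/-- The pairing `∫ f div^α φ`. -/
def fracPairing (α : ℝ) (f : Rn n → ℝ) (φ : Rn n → Rn n) : ℝ := ∫ x, f x * fracDiv α φ x

theorem IsTest.const_smul {φ : Rn n → Rn n} (hφ : IsTest φ) (c : ℝ) : IsTest fun x => c • φ x :=
  ⟨contDiff_const.fun_smul hφ.1, hφ.2.smul_left (f := fun _ => c)⟩

theorem IsTest.sub {φ ψ : Rn n → Rn n} (hφ : IsTest φ) (hψ : IsTest ψ) :
    IsTest fun x => φ x - ψ x := ⟨hφ.1.sub hψ.1, hφ.2.sub hψ.2⟩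

theorem fracPairing_smul (c : ℝ) (φ : Rn n → Rn n) :
    fracPairing α f (fun x => c • φ x) = c * fracPairing α f φ := by
  rw [fracPairing, fracPairing, ← integral_const_mul]
  congr 1 with x
  rw [fracDiv_eq, fracDiv_eq]
  simp only [← smul_sub, inner_smul_left]
  rw [integral_const_mul]
  simp only [conj_trivial]
  ring

theorem fracPairing_sub (hn : 1 ≤ n) (hα0 : 0 < α) (hα1 : α < 1) (hf : AEStronglyMeasurable f)
    (hf1 : ∀ x, ‖f x‖ ≤ 1) {φ ψ : Rn n → Rn n} (hφ : IsTest φ) (hψ : IsTest ψ) :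
    fracPairing α f (fun x => φ x - ψ x) = fracPairing α f φ - fracPairing α f ψ := by
  rw [fracPairing, fracPairing, fracPairing, ← integral_sub
    (integrable_bounded_mul hf hf1 (hφ.integrable_fracDiv hn hα0 hα1))
    (integrable_bounded_mul hf hf1 (hψ.integrable_fracDiv hn hα0 hα1))]
  congr 1 with x
  obtain ⟨C, _, hC⟩ := exists_boundedLipschitz hφ.1 hφ.2
  obtain ⟨C', _, hC'⟩ := exists_boundedLipschitz hψ.1 hψ.2
  rw [fracDiv_eq, fracDiv_eq, fracDiv_eq, ← mul_sub, ← mul_sub, ← integral_sub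
    (hC.integrable_inner hn hα0 hα1 x) (hC'.integrable_inner hn hα0 hα1 x)]
  simp only [← inner_sub_left]
  congr 3 with y
  congr 1
  abel

/-! ### Fractional gradients of mollifications -/

variable {ρ : Rn n → ℝ} {ε : ℝ}

/-- The fractional gradient of a mollifier, without its normalizing constant. -/
def gradKernel (α : ℝ) (ρ : Rn n → ℝ) (w : Rn n) : Rn n :=
  ∫ y, (ρ y - ρ w) • kernel n α (y - w)

theorem IsMollifier.gradKernel_neg (hρ : IsMollifier ρ ε) (w : Rn n) :
    gradKernel α ρ (-w) = -gradKernel α ρ w := by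
  rw [gradKernel, ← integral_neg_eq_self, gradKernel, ← integral_neg]
  congr 1 with y
  rw [hρ.neg, hρ.neg, show -y - -w = -(y - w) by abel, kernel_neg, smul_neg]

/-- Integrability on the whole space is what allows convolution with a function that is only
bounded. -/
theorem IsMollifier.integrable_gradKernel (hρ : IsMollifier ρ ε) (hn : 1 ≤ n) (hα0 : 0 < α)
    (hα1 : α < 1) : Integrable (gradKernel α ρ) := by
  obtain ⟨C, _, hC⟩ := exists_boundedLipschitz hρ.contDiff hρ.hasCompactSupport
  have h : Integrable (fun p : Rn n × Rn n => (ρ p.2 - ρ p.1) • kernel n α (p.2 - p.1))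
      (volume.prod volume) := by
    refine (hC.integrable_prod hρ.hasCompactSupport hn hα0 hα1).mono' ?_
      (Eventually.of_forall fun p => (norm_smul _ _).le)
    have : Measurable fun p : Rn n × Rn n => kernel n α (p.2 - p.1) :=
      measurable_kernel.comp (measurable_snd.sub measurable_fst)
    exact ((hC.1.comp continuous_snd).sub (hC.1.comp continuous_fst)).aestronglyMeasurable.smul
      this.aestronglyMeasurable
  exact h.integral_prod_left

/-- Fubini puts the difference on $\rho$, and a translation by $z$ turns the inner integral into the
gradient kernel at $x-z$. -/
theorem IsMollifier.integral_inner_mollify (hρ : IsMollifier ρ ε) (hn : 1 ≤ n) (hα0 : 0 < α)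
    (hα1 : α < 1) {F : Rn n → Rn n} {M : ℝ} (hF : AEStronglyMeasurable F) (hM : ∀ x, ‖F x‖ ≤ M)
    (x : Rn n) :
    ∫ y, inner ℝ (mollify ρ F y - mollify ρ F x) (kernel n α (y - x)) =
      ∫ z, inner ℝ (F z) (gradKernel α ρ (x - z)) := by
  obtain ⟨C, _, hC⟩ := exists_boundedLipschitz hρ.contDiff hρ.hasCompactSupport
  let H : Rn n → Rn n → ℝ := fun y z => (ρ (y - z) - ρ (x - z)) * inner ℝ (F z) (kernel n α (y - x))
  have hK : Measurable fun y => kernel n α (y - x) :=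
    measurable_kernel.comp (measurable_id.sub_const x)
  -- The substitution $(y,z)\mapsto(x-z,\,y-z)$ reduces the bound to
  -- `BoundedLipschitz.integrable_prod` for $\rho$.
  have hmp : MeasurePreserving (fun p : Rn n × Rn n => (x - p.2, -p.2 + p.1))
      (volume.prod volume) (volume.prod volume) :=
    ((Measure.measurePreserving_sub_left volume x).prod (MeasurePreserving.id volume)).comp
      ((measurePreserving_prod_neg_add volume volume).comp Measure.measurePreserving_swap)
  have hint : Integrable (Function.uncurry H) (volume.prod volume) := by
    have h0 := hC.integrable_prod hρ.hasCompactSupport hn hα0 hα1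
    have h1 := ((hmp.integrable_comp h0.1).2 h0).const_mul M
    refine h1.mono' ?_ (Eventually.of_forall fun p => ?_)
    · refine AEStronglyMeasurable.mul ?_ ?_
      · refine Continuous.aestronglyMeasurable ?_
        have := hC.1
        fun_prop
      · exact hF.comp_snd.inner (hK.aestronglyMeasurable.comp_fst)
    · simp only [Function.uncurry, H, Function.comp_apply]
      rw [norm_mul, show -p.2 + p.1 - (x - p.2) = p.1 - x by abel,
        show -p.2 + p.1 = p.1 - p.2 by abel]
      have h3 : ‖inner ℝ (F p.2) (kernel n α (p.1 - x))‖ ≤ M * ‖kernel n α (p.1 - x)‖ :=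
        (norm_inner_le_norm _ _).trans (mul_le_mul_of_nonneg_right (hM _) (norm_nonneg _))
      calc _ ≤ ‖ρ (p.1 - p.2) - ρ (x - p.2)‖ * (M * ‖kernel n α (p.1 - x)‖) := by gcongr
        _ = _ := by ring
  have h1 (y : Rn n) : inner ℝ (mollify ρ F y - mollify ρ F x) (kernel n α (y - x)) =
      ∫ z, H y z := by
    have i0 : Integrable fun z => ρ (y - z) • F z - ρ (x - z) • F z :=
      (hρ.integrable_smul hF hM y).sub (hρ.integrable_smul hF hM x)
    rw [mollify, mollify, ← integral_sub (hρ.integrable_smul hF hM y)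
      (hρ.integrable_smul hF hM x), real_inner_comm, ← integral_inner i0]
    congr 1 with z
    rw [← sub_smul, inner_smul_right, real_inner_comm]
  simp only [h1]
  rw [integral_integral_swap hint]
  congr 1 with z
  have h2 : gradKernel α ρ (x - z) = ∫ y, (ρ (y - z) - ρ (x - z)) • kernel n α (y - x) := by
    rw [gradKernel, ← integral_sub_right_eq_self _ z]
    congr 1 with y
    rw [show y - z - (x - z) = y - x by abel]
  have h3 : Integrable fun y => (ρ (y - z) - ρ (x - z)) • kernel n α (y - x) := by
    have h4 := ((hC.integrable hn hα0 hα1 (x - z)).comp_sub_right z)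
    refine h4.mono' ?_ (Eventually.of_forall fun y => ?_)
    · have h5 : Continuous fun y => ρ (y - z) - ρ (x - z) :=
        (hC.1.comp (continuous_sub_right z)).sub continuous_const
      exact h5.aestronglyMeasurable.smul hK.aestronglyMeasurable
    · rw [show y - z - (x - z) = y - x by abel, norm_smul]
  rw [h2, ← integral_inner h3]
  congr 1 with y
  rw [inner_smul_right]

/-- The fractional gradient of the mollification of `f`, without its normalizing constant. -/
def mollGrad (α : ℝ) (ρ : Rn n → ℝ) (f : Rn n → ℝ) (x : Rn n) : Rn n :=
  ∫ z, f z • gradKernel α ρ (x - z)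

theorem IsMollifier.integrable_smul_gradKernel (hρ : IsMollifier ρ ε) (hn : 1 ≤ n) (hα0 : 0 < α)
    (hα1 : α < 1) (hf : AEStronglyMeasurable f) (hf1 : ∀ x, ‖f x‖ ≤ 1) (x : Rn n) :
    Integrable fun z => f z • gradKernel α ρ (x - z) :=
  ((hρ.integrable_gradKernel hn hα0 hα1).comp_sub_left x).bdd_smul 1 hf (Eventually.of_forall hf1)

theorem IsMollifier.integral_mollify_mul_inner (hρ : IsMollifier ρ ε) (hn : 1 ≤ n) (hα0 : 0 < α)
    (hα1 : α < 1) (hf : AEStronglyMeasurable f) (hf1 : ∀ x, ‖f x‖ ≤ 1) (x v : Rn n) :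
    ∫ y, (mollify ρ f y - mollify ρ f x) * inner ℝ v (kernel n α (y - x)) =
      inner ℝ v (mollGrad α ρ f x) := by
  have h := hρ.integral_inner_mollify hn hα0 hα1 (F := fun z => f z • v) (M := ‖v‖)
    (hf.smul_const v) (fun z => by
      rw [norm_smul]; nlinarith [hf1 z, norm_nonneg v]) x
  have h1 (y : Rn n) : mollify ρ (fun z => f z • v) y = mollify ρ f y • v := by
    simp only [mollify]
    rw [← integral_smul_const]
    congr 1 with z
    rw [smul_assoc]
  simp only [h1, ← sub_smul, inner_smul_left, conj_trivial] at h
  rw [h, mollGrad, ← integral_inner (hρ.integrable_smul_gradKernel hn hα0 hα1 hf hf1 x)]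
  congr 1 with z
  rw [inner_smul_right]

theorem IsMollifier.norm_mollGrad_le (hρ : IsMollifier ρ ε) (hn : 1 ≤ n) (hα0 : 0 < α)
    (hα1 : α < 1) (hf1 : ∀ x, ‖f x‖ ≤ 1) (x : Rn n) :
    ‖mollGrad α ρ f x‖ ≤ ∫ z, ‖gradKernel α ρ z‖ := by
  rw [← integral_sub_left_eq_self (fun z => ‖gradKernel α ρ z‖) volume x]
  refine norm_integral_le_of_norm_le
    ((hρ.integrable_gradKernel hn hα0 hα1).comp_sub_left x).norm (Eventually.of_forall fun z => ?_)
  rw [norm_smul]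
  exact mul_le_of_le_one_left (norm_nonneg _) (hf1 z)

theorem IsMollifier.aestronglyMeasurable_mollGrad (hρ : IsMollifier ρ ε) (hn : 1 ≤ n)
    (hα0 : 0 < α) (hα1 : α < 1) (hf : AEStronglyMeasurable f) :
    AEStronglyMeasurable (mollGrad α ρ f) := by
  have h1 : AEStronglyMeasurable (fun p : Rn n × Rn n => f p.2 • gradKernel α ρ (p.1 - p.2))
      (volume.prod volume) :=
    hf.comp_snd.smul ((hρ.integrable_gradKernel hn hα0 hα1).1.comp_quasiMeasurePreserving
      (quasiMeasurePreserving_sub volume volume))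
  exact h1.integral_prod_right'

theorem integrable_of_bounded_of_eq_zero {F : Rn n → Rn n} {M R : ℝ}
    (hF : AEStronglyMeasurable F) (hM : ∀ x, ‖F x‖ ≤ M) (hR : ∀ x, R ≤ ‖x‖ → F x = 0) :
    Integrable F := by
  refine (integrableOn_iff_integrable_of_support_subset (s := Metric.ball 0 R) ?_).1
    ⟨hF.restrict, HasFiniteIntegral.restrict_of_bounded (C := M) measure_ball_lt_top
      (Eventually.of_forall hM)⟩
  intro x hx
  by_contra h
  exact hx (hR x (by simpa using h))

/-- Fubini moves the mollification from $F$ to $f$, and the oddness of the gradient kernel gives the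
sign. Since $F$ need not be smooth, the sign field of a gradient and $f\varphi$ are both admissible.
-/
theorem IsMollifier.fracPairing_mollify (hρ : IsMollifier ρ ε) (hn : 1 ≤ n) (hα0 : 0 < α)
    (hα1 : α < 1) (hf : AEStronglyMeasurable f) (hf1 : ∀ x, ‖f x‖ ≤ 1) {F : Rn n → Rn n} {M : ℝ}
    (hF : Integrable F) (hM : ∀ x, ‖F x‖ ≤ M) :
    fracPairing α f (mollify ρ F) =
      -∫ x, inner ℝ (F x) (muConst n α • mollGrad α ρ f x) := by
  have hG := hρ.integrable_gradKernel hn hα0 hα1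
  let H : Rn n → Rn n → ℝ := fun x z => f x * inner ℝ (F z) (gradKernel α ρ (x - z))
  have hint : Integrable (Function.uncurry H) (volume.prod volume) := by
    have h0 := (hF.norm.mul_prod hG.norm)
    have hmp : MeasurePreserving (fun p : Rn n × Rn n => (p.2, -p.2 + p.1))
        (volume.prod volume) (volume.prod volume) :=
      (measurePreserving_prod_neg_add volume volume).comp Measure.measurePreserving_swap
    have h1 := (hmp.integrable_comp h0.1).2 h0
    refine h1.mono' ?_ (Eventually.of_forall fun p => ?_)
    · exact hf.comp_fst.mul (hF.1.comp_snd.inner (hG.1.comp_quasiMeasurePreserving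
        (quasiMeasurePreserving_sub volume volume)))
    · simp only [Function.uncurry, H, Function.comp_apply]
      rw [norm_mul, neg_add_eq_sub]
      exact (mul_le_of_le_one_left (norm_nonneg _) (hf1 _)).trans (norm_inner_le_norm _ _)
  have h1 (x : Rn n) : f x * fracDiv α (mollify ρ F) x = muConst n α * ∫ z, H x z := by
    rw [fracDiv_eq, hρ.integral_inner_mollify hn hα0 hα1 hF.1 hM x, integral_const_mul]
    ring
  rw [fracPairing]
  simp only [h1]
  rw [integral_const_mul, integral_integral_swap hint, ← integral_neg, ← integral_const_mul]
  congr 1 with z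
  have h2 : mollGrad α ρ f z = -∫ x, f x • gradKernel α ρ (x - z) := by
    rw [mollGrad, ← integral_neg]
    congr 1 with x
    rw [← neg_sub, hρ.gradKernel_neg, smul_neg]
  have h3 : Integrable fun x => f x • gradKernel α ρ (x - z) :=
    (hG.comp_sub_right z).bdd_smul 1 hf (Eventually.of_forall hf1)
  rw [h2, inner_smul_right, inner_neg_right, ← integral_inner h3]
  simp only [inner_smul_right, H]
  ring

end Duality

/-! ### Weak-star compactness of vector-valued Radon measures -/

section Compactness

variable {n : ℕ}

/-- Limits along one fixed ultrafilter replace a diagonal extraction: the same $U$ serves every test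
function. -/
theorem exists_tendsto_ultrafilter (U : Ultrafilter ℕ) {a : ℕ → ℝ} {C : ℝ} (h : ∀ k, |a k| ≤ C) :
    ∃ l, Tendsto a U (𝓝 l) := by
  obtain ⟨l, _, hl⟩ := (isCompact_Icc (a := -C) (b := C)).ultrafilter_le_nhds (U.map a)
    (by
      rw [le_principal_iff]
      exact Filter.mem_map.2 (Filter.mem_of_superset univ_mem fun k _ => abs_le.1 (h k)))
  exact ⟨l, hl⟩

theorem integrable_mul_of_hasCompactSupport {g w : Rn n → ℝ} (hg : Continuous g)
    (hc : HasCompactSupport g) {R : ℝ} (hR : tsupport g ⊆ Metric.ball 0 R)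
    (hw : IntegrableOn w (Metric.ball 0 R)) : Integrable fun x => g x * w x := by
  obtain ⟨C, hC⟩ := hg.bounded_above_of_compact_support hc
  refine (integrableOn_iff_integrable_of_support_subset (s := Metric.ball 0 R) ?_).1
    (hw.bdd_mul hg.aestronglyMeasurable.restrict (Eventually.of_forall hC))
  exact ((Function.support_mul_subset_left _ _).trans (subset_tsupport g)).trans hR

theorem exists_tsupport_subset_ball {F : Type*} [Zero F] {g : Rn n → F}
    (hc : HasCompactSupport g) : ∃ R, tsupport g ⊆ Metric.ball 0 R :=
  hc.isBounded.subset_ball 0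

theorem abs_integral_mul_le {g w : Rn n → ℝ} {C R : ℝ} (hC : ∀ x, ‖g x‖ ≤ C)
    (hR : tsupport g ⊆ Metric.ball 0 R)
    (hw : IntegrableOn w (Metric.ball 0 R)) (hw0 : ∀ x, 0 ≤ w x) :
    |∫ x, g x * w x| ≤ C * ∫ x in Metric.ball 0 R, w x := by
  have h1 : ∫ x, g x * w x = ∫ x in Metric.ball 0 R, g x * w x :=
    (setIntegral_eq_integral_of_forall_compl_eq_zero fun x hx => by
      rw [image_eq_zero_of_notMem_tsupport fun h => hx (hR h), zero_mul]).symm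
  rw [h1, ← Real.norm_eq_abs, ← integral_const_mul]
  refine norm_integral_le_of_norm_le (hw.const_mul C) (Eventually.of_forall fun x => ?_)
  rw [norm_mul, Real.norm_of_nonneg (hw0 x)]
  exact mul_le_mul_of_nonneg_right (hC x) (hw0 x)

/-- The limits along $U$ form a positive linear functional on $C_c$, which the Riesz–Markov theorem
represents. -/
theorem exists_measure_tendsto_integral (U : Ultrafilter ℕ) {w : ℕ → Rn n → ℝ}
    (hw0 : ∀ k x, 0 ≤ w k x) (hw : ∀ k R, IntegrableOn (w k) (Metric.ball 0 R))
    (hb : ∀ R, ∃ C, ∀ k, ∫ x in Metric.ball 0 R, w k x ≤ C) :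
    ∃ P : Measure (Rn n), P.Regular ∧ ∀ g : Rn n → ℝ, Continuous g → HasCompactSupport g →
      Tendsto (fun k => ∫ x, g x * w k x) U (𝓝 (∫ x, g x ∂P)) := by
  have hlim (g : CompactlySupportedContinuousMap (Rn n) ℝ) :
      ∃ l, Tendsto (fun k => ∫ x, g x * w k x) U (𝓝 l) := by
    obtain ⟨R, hR⟩ := exists_tsupport_subset_ball g.hasCompactSupport
    obtain ⟨M, hM⟩ := g.continuous.bounded_above_of_compact_support g.hasCompactSupport
    obtain ⟨C, hC⟩ := hb R
    refine exists_tendsto_ultrafilter U (C := M * C) fun k => ?_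
    exact (abs_integral_mul_le hM hR (hw k R) (hw0 k)).trans
      (mul_le_mul_of_nonneg_left (hC k) ((norm_nonneg _).trans (hM 0)))
  choose L hL using hlim
  have hint (g : CompactlySupportedContinuousMap (Rn n) ℝ) (k : ℕ) :
      Integrable fun x => g x * w k x := by
    obtain ⟨R, hR⟩ := exists_tsupport_subset_ball g.hasCompactSupport
    exact integrable_mul_of_hasCompactSupport g.continuous g.hasCompactSupport hR (hw k R)
  let Λ : CompactlySupportedContinuousMap (Rn n) ℝ →ₚ[ℝ] ℝ := PositiveLinearMap.mk₀
    { toFun := L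
      map_add' := fun g h => by
        refine tendsto_nhds_unique (hL (g + h)) (((hL g).add (hL h)).congr fun k => ?_)
        rw [← integral_add (hint g k) (hint h k)]
        congr 1 with x
        simp [add_mul]
      map_smul' := fun c g => by
        refine tendsto_nhds_unique (hL (c • g)) (((hL g).const_mul c).congr fun k => ?_)
        rw [← integral_const_mul]
        congr 1 with x
        simp [mul_assoc] }
    (fun g hg => ge_of_tendsto' (hL g) fun k =>
      integral_nonneg fun x => mul_nonneg (hg x) (hw0 k x))
  refine ⟨RealRMK.rieszMeasure Λ, inferInstance, fun g hg hc => ?_⟩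
  let g' : CompactlySupportedContinuousMap (Rn n) ℝ := ⟨⟨g, hg⟩, hc⟩
  have h1 : ∫ x, g x ∂(RealRMK.rieszMeasure Λ) = L g' := RealRMK.integral_rieszMeasure Λ g'
  rw [h1]
  exact hL g'

/-- A sequence of vector fields bounded in `L¹_loc` converges weakly-star, along an ultrafilter,
to a vector-valued Radon measure. -/
theorem exists_density_tendsto_integral (U : Ultrafilter ℕ) {w : ℕ → Rn n → Rn n}
    (hw : ∀ k R, IntegrableOn (w k) (Metric.ball 0 R))
    (hb : ∀ R, ∃ C, ∀ k, ∫ x in Metric.ball 0 R, ‖w k x‖ ≤ C) :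
    ∃ (m : Measure (Rn n)) (_ : IsFiniteMeasure m) (σ : Rn n → Rn n), Measurable σ ∧
      (∀ R, IntegrableOn σ (Metric.ball 0 R) m) ∧
      ∀ φ : Rn n → Rn n, Continuous φ → HasCompactSupport φ →
        Tendsto (fun k => ∫ x, inner ℝ (φ x) (w k x)) U (𝓝 (∫ x, inner ℝ (φ x) (σ x) ∂m)) := by
  have hwi (k : ℕ) (R : ℝ) (i : Fin n) : IntegrableOn (fun x => w k x i) (Metric.ball 0 R) :=
    (EuclideanSpace.proj (𝕜 := ℝ) i).integrable_comp (hw k R)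
  have hle (k : ℕ) (x : Rn n) (i : Fin n) : |w k x i| ≤ ‖w k x‖ := PiLp.norm_apply_le (w k x) i
  have hP (i : Fin n) := exists_measure_tendsto_integral U (w := fun k x => max (w k x i) 0)
    (fun k x => le_max_right _ _) (fun k R => (hwi k R i).pos_part)
    (fun R => by
      obtain ⟨C, hC⟩ := hb R
      refine ⟨C, fun k => (integral_mono (hwi k R i).pos_part (hw k R).norm
        fun x => ?_).trans (hC k)⟩
      exact max_le ((le_abs_self _).trans (hle k x i)) (norm_nonneg _))
  have hM (i : Fin n) := exists_measure_tendsto_integral U (w := fun k x => max (-(w k x i)) 0)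
    (fun k x => le_max_right _ _) (fun k R => (hwi k R i).neg_part)
    (fun R => by
      obtain ⟨C, hC⟩ := hb R
      refine ⟨C, fun k => (integral_mono (hwi k R i).neg_part (hw k R).norm
        fun x => ?_).trans (hC k)⟩
      exact max_le ((neg_le_abs _).trans (hle k x i)) (norm_nonneg _))
  choose P hPr hP using hP
  choose M hMr hM using hM
  -- The limits of the positive and negative parts may have infinite mass. Dominating them by a
  -- finite measure is possible because their densities need only be locally integrable.
  let m : Measure (Rn n) := ∑ i, ((P i).toFinite + (M i).toFinite)
  have hm : IsFiniteMeasure m := by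
    refine ⟨?_⟩
    simp only [m, Measure.finsetSum_apply, ENNReal.sum_lt_top]
    intro i _
    exact measure_lt_top _ _
  have hle (i : Fin n) : (P i).toFinite + (M i).toFinite ≤ m := by
    refine Measure.le_iff.2 fun A _ => ?_
    simp only [m, Measure.finsetSum_apply]
    exact Finset.single_le_sum (f := fun i => ((P i).toFinite + (M i).toFinite) A)
      (fun _ _ => zero_le) (Finset.mem_univ i)
  have hPm (i : Fin n) : P i ≪ m := (absolutelyContinuous_toFinite (P i)).trans
    ((Measure.le_add_right le_rfl).trans (hle i)).absolutelyContinuous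
  have hMm (i : Fin n) : M i ≪ m := (absolutelyContinuous_toFinite (M i)).trans
    ((Measure.le_add_left le_rfl).trans (hle i)).absolutelyContinuous
  have hiP (i : Fin n) (R : ℝ) :
      IntegrableOn (fun x => ((P i).rnDeriv m x).toReal) (Metric.ball 0 R) m :=
    Measure.integrableOn_toReal_rnDeriv (Metric.isBounded_ball.measure_lt_top).ne
  have hiM (i : Fin n) (R : ℝ) :
      IntegrableOn (fun x => ((M i).rnDeriv m x).toReal) (Metric.ball 0 R) m :=
    Measure.integrableOn_toReal_rnDeriv (Metric.isBounded_ball.measure_lt_top).ne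
  let σ : Rn n → Rn n := fun x => WithLp.toLp 2 fun i =>
    ((P i).rnDeriv m x).toReal - ((M i).rnDeriv m x).toReal
  refine ⟨m, hm, σ, ?_, fun R => ?_, fun φ hφ hc => ?_⟩
  · refine (WithLp.measurable_toLp 2 _).comp (measurable_pi_lambda _ fun i => ?_)
    exact ((P i).measurable_rnDeriv m).ennreal_toReal.sub
      ((M i).measurable_rnDeriv m).ennreal_toReal
  · exact Integrable.of_eval_piLp fun i => (hiP i R).sub (hiM i R)
  · obtain ⟨R, hR⟩ := exists_tsupport_subset_ball hc
    have hφi (i : Fin n) : Continuous fun x => φ x i :=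
      (EuclideanSpace.proj (𝕜 := ℝ) i).continuous.comp hφ
    have hci (i : Fin n) : HasCompactSupport fun x => φ x i :=
      hc.comp_left (g := fun v : Rn n => v i) rfl
    have hRi (i : Fin n) : tsupport (fun x => φ x i) ⊆ Metric.ball 0 R :=
      (tsupport_comp_subset (g := fun v : Rn n => v i) rfl φ).trans hR
    have hbd (i : Fin n) : ∃ C, ∀ x, ‖φ x i‖ ≤ C :=
      (hφi i).bounded_above_of_compact_support (hci i)
    have e1 (k : ℕ) : ∫ x, inner ℝ (φ x) (w k x) =
        ∑ i, ((∫ x, φ x i * max (w k x i) 0) - ∫ x, φ x i * max (-(w k x i)) 0) := by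
      have i1 (i : Fin n) := integrable_mul_of_hasCompactSupport (hφi i) (hci i) (hRi i)
        (hwi k R i).pos_part
      have i2 (i : Fin n) := integrable_mul_of_hasCompactSupport (hφi i) (hci i) (hRi i)
        (hwi k R i).neg_part
      simp only [← integral_sub (i1 _) (i2 _)]
      have i3 (i : Fin n) : Integrable fun x =>
          φ x i * max (w k x i) 0 - φ x i * max (-(w k x i)) 0 := (i1 i).sub (i2 i)
      rw [← integral_finsetSum _ fun i _ => i3 i]
      congr 1 with x
      rw [PiLp.inner_apply]
      refine Finset.sum_congr rfl fun i _ => ?_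
      rw [← mul_sub, max_zero_sub_eq_self (w k x i)]
      simp [mul_comm]
    have e2 : ∫ x, inner ℝ (φ x) (σ x) ∂m =
        ∑ i, ((∫ x, φ x i ∂(P i)) - ∫ x, φ x i ∂(M i)) := by
      have hint (i : Fin n) {r : Rn n → ℝ} (hr : IntegrableOn r (Metric.ball 0 R) m) :
          Integrable (fun x => r x * φ x i) m := by
        obtain ⟨C, hC⟩ := hbd i
        refine (integrableOn_iff_integrable_of_support_subset (s := Metric.ball 0 R) ?_).1
          (hr.mul_bdd (c := C) (hφi i).aestronglyMeasurable.restrict (Eventually.of_forall hC))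
        exact ((Function.support_mul_subset_right _ _).trans (subset_tsupport _)).trans (hRi i)
      simp only [← integral_toReal_rnDeriv_mul (hPm _), ← integral_toReal_rnDeriv_mul (hMm _)]
      simp only [← integral_sub (hint _ (hiP _ R)) (hint _ (hiM _ R))]
      have i3 (i : Fin n) : Integrable (fun x => ((P i).rnDeriv m x).toReal * φ x i -
          ((M i).rnDeriv m x).toReal * φ x i) m := (hint i (hiP i R)).sub (hint i (hiM i R))
      rw [← integral_finsetSum _ fun i _ => i3 i]
      congr 1 with x
      rw [PiLp.inner_apply]
      refine Finset.sum_congr rfl fun i _ => ?_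
      simp [σ, sub_mul]
    simp only [e1, e2]
    exact tendsto_finsetSum _ fun i _ =>
      (hP i _ (hφi i) (hci i)).sub (hM i _ (hφi i) (hci i))

end Compactness

/-! ### Existence of the fractional variation measure -/

section FracVariation

variable {n : ℕ} {α : ℝ} {f : Rn n → ℝ}

/-- The one-sided supremum over unit fields becomes a two-sided homogeneous bound by rescaling with
$\pm s^{-1}$. -/
theorem MemBVloc.exists_bound {p : ℝ≥0∞} (hf : MemBVloc α p f) (R : ℝ) :
    ∃ C, 0 ≤ C ∧ ∀ φ : Rn n → Rn n, IsTest φ → tsupport φ ⊆ Metric.ball 0 R →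
      ∀ s, (∀ x, ‖φ x‖ ≤ s) → |fracPairing α f φ| ≤ C * s := by
  obtain ⟨C, hC⟩ := hf.2 (Metric.ball 0 R) Metric.isOpen_ball
    (Metric.isBounded_ball.isCompact_closure)
  have key : ∀ φ : Rn n → Rn n, IsTest φ → tsupport φ ⊆ Metric.ball 0 R →
      (∀ x, ‖φ x‖ ≤ 1) → fracPairing α f φ ≤ C := fun φ hφ hR h1 => hC ⟨φ, hφ, h1, hR, rfl⟩
  have h0 (φ : Rn n → Rn n) : fracPairing α f (fun x => (0 : ℝ) • φ x) = 0 := by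
    rw [fracPairing_smul, zero_mul]
  have hsupp (c : ℝ) {φ : Rn n → Rn n} (hR : tsupport φ ⊆ Metric.ball 0 R) :
      tsupport (fun x => c • φ x) ⊆ Metric.ball 0 R :=
    (closure_mono (Function.support_const_smul_subset c φ)).trans hR
  have hz : IsTest (fun _ => 0 : Rn n → Rn n) := ⟨contDiff_const, HasCompactSupport.zero⟩
  have hC0 : 0 ≤ C := by
    have := key _ (hz.const_smul 0) (hsupp 0 (by simp [tsupport])) (by simp)
    rwa [h0] at this
  refine ⟨C, hC0, fun φ hφ hR s hs => ?_⟩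
  have hs0 : 0 ≤ s := (norm_nonneg _).trans (hs 0)
  rcases hs0.eq_or_lt with rfl | hs0
  · have : φ = fun x => (0 : ℝ) • φ x := by
      funext x
      simpa using hs x
    rw [this, h0]
    simp
  · have h1 : ∀ c : ℝ, |c| = s⁻¹ → c * fracPairing α f φ ≤ C := by
      intro c hc
      rw [← fracPairing_smul]
      refine key _ (hφ.const_smul c) (hsupp c hR) fun x => ?_
      rw [norm_smul, Real.norm_eq_abs, hc, inv_mul_le_one₀ hs0]
      exact hs x
    have h2 := h1 s⁻¹ (abs_of_pos (inv_pos.2 hs0))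
    have h3 := h1 (-s⁻¹) (by rw [abs_neg, abs_of_pos (inv_pos.2 hs0)])
    rw [← div_eq_inv_mul, div_le_iff₀ hs0] at h2
    rw [neg_mul, ← div_eq_inv_mul, ← neg_div, div_le_iff₀ hs0] at h3
    exact abs_le.2 ⟨by linarith, h2⟩

/-- Test with the mollification of the unit field $w/|w|$ cut off to the ball: by duality the
pairing is exactly $-\int|w|$, and since $\varepsilon\le1$ the support stays inside radius $R+2$. -/
theorem IsMollifier.integral_norm_mollGrad_le {ρ : Rn n → ℝ} {ε : ℝ} (hρ : IsMollifier ρ ε)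
    (hε : ε ≤ 1) (hn : 1 ≤ n)
    (hα0 : 0 < α) (hα1 : α < 1) (hf : AEStronglyMeasurable f) (hf1 : ∀ x, ‖f x‖ ≤ 1) {R C : ℝ}
    (hC : ∀ φ : Rn n → Rn n, IsTest φ → tsupport φ ⊆ Metric.ball 0 (R + 2) →
      (∀ x, ‖φ x‖ ≤ 1) → |fracPairing α f φ| ≤ C) :
    ∫ x in Metric.ball 0 R, ‖muConst n α • mollGrad α ρ f x‖ ≤ C := by
  let w : Rn n → Rn n := fun x => muConst n α • mollGrad α ρ f x
  have hwm : AEStronglyMeasurable w := by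
    exact (hρ.aestronglyMeasurable_mollGrad hn hα0 hα1 hf).const_smul (muConst n α)
  -- Where $w=0$ the convention $0^{-1}=0$ makes the field vanish.
  let F : Rn n → Rn n := (Metric.ball 0 R).indicator fun x => ‖w x‖⁻¹ • w x
  have hFm : AEStronglyMeasurable F :=
    (hwm.norm.inv₀.smul hwm).indicator measurableSet_ball
  have hF1 : ∀ x, ‖F x‖ ≤ 1 := by
    intro x
    by_cases hx : x ∈ Metric.ball (0 : Rn n) R
    · simp only [F, indicator_of_mem hx, norm_smul, norm_inv, norm_norm]
      exact inv_mul_le_one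
    · simp [F, indicator_of_notMem hx]
  have hFR : ∀ x, R ≤ ‖x‖ → F x = 0 := fun x hx =>
    indicator_of_notMem (by simpa using hx) _
  have h1 := hC (mollify ρ F) (hρ.isTest_mollify hFm hF1 hFR)
    (hρ.tsupport_mollify_subset hFR (by linarith)) (hρ.norm_mollify_le hFm hF1)
  rw [hρ.fracPairing_mollify hn hα0 hα1 hf hf1
    (integrable_of_bounded_of_eq_zero hFm hF1 hFR) hF1, abs_neg] at h1
  refine le_trans (le_of_eq ?_) ((le_abs_self _).trans h1)
  rw [← integral_indicator measurableSet_ball]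
  congr 1 with x
  by_cases hx : x ∈ Metric.ball (0 : Rn n) R
  · rw [indicator_of_mem hx]
    change ‖w x‖ = inner ℝ (F x) (w x)
    simp only [F, indicator_of_mem hx, inner_smul_left, conj_trivial, real_inner_self_eq_norm_sq]
    by_cases h : ‖w x‖ = 0
    · simp [h]
    · field_simp
  · simp [F, indicator_of_notMem hx]

/-- The mollified fields converge uniformly with supports in a fixed ball, and the local variation
bound is continuity of the pairing for exactly this convergence. -/
theorem tendsto_fracPairing_mollify (hn : 1 ≤ n) (hα0 : 0 < α) (hα1 : α < 1) {p : ℝ≥0∞}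
    (hBV : MemBVloc α p f) (hf : AEStronglyMeasurable f) (hf1 : ∀ x, ‖f x‖ ≤ 1)
    {ρ : ℕ → Rn n → ℝ} {ε : ℕ → ℝ} (hρ : ∀ k, IsMollifier (ρ k) (ε k)) (hε1 : ∀ k, ε k ≤ 1)
    (hε : Tendsto ε atTop (𝓝 0)) {φ : Rn n → Rn n} (hφ : IsTest φ) :
    Tendsto (fun k => fracPairing α f (mollify (ρ k) φ)) atTop (𝓝 (fracPairing α f φ)) := by
  obtain ⟨C, hC0, hC⟩ := exists_boundedLipschitz hφ.1 hφ.2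
  obtain ⟨M, hM⟩ := hφ.1.continuous.bounded_above_of_compact_support hφ.2
  obtain ⟨R, hR⟩ := exists_tsupport_subset_ball hφ.2
  obtain ⟨B, hB0, hB⟩ := hBV.exists_bound (R + 2)
  have hφR : ∀ x, R ≤ ‖x‖ → φ x = 0 := fun x hx =>
    image_eq_zero_of_notMem_tsupport fun h => by
      have := hR h
      simp at this
      linarith
  rw [tendsto_iff_norm_sub_tendsto_zero]
  refine squeeze_zero (fun k => norm_nonneg _) (g := fun k => B * (C * ε k)) (fun k => ?_) ?_
  · have ht := (hρ k).isTest_mollify hφ.1.continuous.aestronglyMeasurable hM hφR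
    rw [← fracPairing_sub hn hα0 hα1 hf hf1 ht hφ]
    refine hB _ (ht.sub hφ) ?_ _ ((hρ k).norm_mollify_sub_self_le hC hC0 hM)
    refine (tsupport_sub _ _).trans (union_subset ?_
      (hR.trans (Metric.ball_subset_ball (by linarith))))
    exact (hρ k).tsupport_mollify_subset hφR (by linarith [hε1 k])
  · simpa using (hε.const_mul C).const_mul B

/-- Pass to the limit in the duality $\int
f\,\mathrm{div}^\alpha(\rho_k*\varphi)=-\int\varphi\cdot\nabla^\alpha(\rho_k*f)$, whose right-hand
fields are bounded in $L^1_{\mathrm{loc}}$. -/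
theorem exists_density_fracVariation (hn : 1 ≤ n) (hα0 : 0 < α) (hα1 : α < 1) {p : ℝ≥0∞}
    (hBV : MemBVloc α p f) (hf : AEStronglyMeasurable f) (hf1 : ∀ x, ‖f x‖ ≤ 1) :
    ∃ (m : Measure (Rn n)) (_ : IsFiniteMeasure m) (σ : Rn n → Rn n), Measurable σ ∧
      (∀ R, IntegrableOn σ (Metric.ball 0 R) m) ∧
      ∀ φ : Rn n → Rn n, IsTest φ → fracPairing α f φ = -∫ x, inner ℝ (φ x) (σ x) ∂m := by
  let ε : ℕ → ℝ := fun k => 1 / ((k : ℝ) + 1)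
  have hε0 (k) : 0 < ε k := Nat.one_div_pos_of_nat
  have hε1 (k) : ε k ≤ 1 := by
    simp only [ε]
    rw [div_le_one (by positivity)]
    linarith [(Nat.cast_nonneg k : (0 : ℝ) ≤ k)]
  have hε : Tendsto ε atTop (𝓝 0) := tendsto_one_div_add_atTop_nhds_zero_nat
  have hρ (k) := isMollifier_radialMollifier (n := n) (hε0 k)
  let w : ℕ → Rn n → Rn n := fun k x => muConst n α • mollGrad α (radialMollifier n (ε k)) f x
  obtain ⟨m, hm, σ, hσ, hσR, h⟩ := exists_density_tendsto_integral (hyperfilter ℕ) (w := w)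
    (fun k R => by
      have hb := (hρ k).norm_mollGrad_le hn hα0 hα1 hf1
      have : IntegrableOn (mollGrad α (radialMollifier n (ε k)) f) (Metric.ball 0 R) :=
        ⟨((hρ k).aestronglyMeasurable_mollGrad hn hα0 hα1 hf).restrict,
          HasFiniteIntegral.restrict_of_bounded
            (C := ∫ z, ‖gradKernel α (radialMollifier n (ε k)) z‖) measure_ball_lt_top
            (Eventually.of_forall hb)⟩
      exact this.smul (muConst n α))
    (fun R => by
      obtain ⟨C, _, hC⟩ := hBV.exists_bound (R + 2)
      refine ⟨C, fun k => (hρ k).integral_norm_mollGrad_le (hε1 k) hn hα0 hα1 hf hf1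
        fun φ hφ hR h1 => ?_⟩
      simpa using hC φ hφ hR 1 h1)
  refine ⟨m, hm, σ, hσ, hσR, fun φ hφ => ?_⟩
  obtain ⟨M, hM⟩ := hφ.1.continuous.bounded_above_of_compact_support hφ.2
  have h1 := (tendsto_fracPairing_mollify hn hα0 hα1 hBV hf hf1 hρ hε1 hε hφ).mono_left
    Nat.hyperfilter_le_atTop
  have h2 := (h φ hφ.1.continuous hφ.2).neg
  refine tendsto_nhds_unique h1 (h2.congr fun k => ?_)
  exact ((hρ k).fracPairing_mollify hn hα0 hα1 hf hf1
    (hφ.1.continuous.integrable_of_hasCompactSupport hφ.2) hM).symm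

end FracVariation

/-! ### Weak limits of bounded functions -/

section WeakLimit

/-- The limits along $U$ form a bounded linear functional, represented by Riesz's theorem. -/
theorem exists_tendsto_inner_ultrafilter {H : Type*} [NormedAddCommGroup H]
    [InnerProductSpace ℝ H] [CompleteSpace H] (U : Ultrafilter ℕ) {x : ℕ → H} {C : ℝ}
    (hC : ∀ k, ‖x k‖ ≤ C) :
    ∃ h : H, ∀ y, Tendsto (fun k => inner ℝ (x k) y) U (𝓝 (inner ℝ h y)) := by
  have hb (y : H) (k : ℕ) : |inner ℝ (x k) y| ≤ C * ‖y‖ :=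
    (abs_real_inner_le_norm _ _).trans (mul_le_mul_of_nonneg_right (hC k) (norm_nonneg _))
  choose L hL using fun y => exists_tendsto_ultrafilter U (hb y)
  let Λ : H →ₗ[ℝ] ℝ :=
    { toFun := L
      map_add' := fun y z => tendsto_nhds_unique (hL (y + z))
        (((hL y).add (hL z)).congr fun k => (inner_add_right _ _ _).symm)
      map_smul' := fun c y => tendsto_nhds_unique (hL (c • y))
        (((hL y).const_mul c).congr fun k => (inner_smul_right _ _ _).symm) }
  let Λ' : StrongDual ℝ H := Λ.mkContinuous C fun y =>
    le_of_tendsto' (hL y).norm fun k => hb y k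
  refine ⟨(InnerProductSpace.toDual ℝ H).symm Λ', fun y => ?_⟩
  rw [InnerProductSpace.toDual_symm_apply]
  exact hL y

variable {X : Type*} [MeasurableSpace X] {m : Measure X} [IsFiniteMeasure m]

omit [IsFiniteMeasure m] in
theorem integrable_mul_of_unit_bound {g ψ : X → ℝ} (hg : Measurable g) (hg0 : ∀ x, 0 ≤ g x)
    (hg1 : ∀ x, g x ≤ 1) (hψ : Integrable ψ m) : Integrable (fun x => g x * ψ x) m :=
  hψ.bdd_mul (c := 1) hg.aestronglyMeasurable
    (Eventually.of_forall fun x => by rw [Real.norm_of_nonneg (hg0 x)]; exact hg1 x)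

omit [IsFiniteMeasure m] in
theorem abs_integral_mul_sub_le {g ψ ψ' : X → ℝ} (hg : Measurable g) (hg0 : ∀ x, 0 ≤ g x)
    (hg1 : ∀ x, g x ≤ 1) (hψ : Integrable ψ m) (hψ' : Integrable ψ' m) :
    |(∫ x, g x * ψ x ∂m) - ∫ x, g x * ψ' x ∂m| ≤ ∫ x, |ψ x - ψ' x| ∂m := by
  rw [← integral_sub (integrable_mul_of_unit_bound hg hg0 hg1 hψ)
    (integrable_mul_of_unit_bound hg hg0 hg1 hψ'), ← Real.norm_eq_abs]
  refine norm_integral_le_of_norm_le (hψ.sub hψ').abs (Eventually.of_forall fun x => ?_)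
  rw [← mul_sub, norm_mul, Real.norm_of_nonneg (hg0 x)]
  exact mul_le_of_le_one_left (norm_nonneg _) (hg1 x)

/-- Since $m$ is finite the sequence is bounded in $L^2$. A weak $L^2$ limit inherits the bounds by
testing on sets, and the convergence extends to $\psi\in L^1$ by density, the $g_k$ being uniformly
bounded. -/
theorem exists_weak_limit (U : Ultrafilter ℕ) {g : ℕ → X → ℝ} (hg : ∀ k, Measurable (g k))
    (hg0 : ∀ k x, 0 ≤ g k x) (hg1 : ∀ k x, g k x ≤ 1) :
    ∃ h : X → ℝ, Measurable h ∧ (∀ x, 0 ≤ h x) ∧ (∀ x, h x ≤ 1) ∧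
      ∀ ψ, Integrable ψ m →
        Tendsto (fun k => ∫ x, g k x * ψ x ∂m) U (𝓝 (∫ x, h x * ψ x ∂m)) := by
  have hgb (k : ℕ) (x : X) : ‖g k x‖ ≤ 1 := by
    rw [Real.norm_of_nonneg (hg0 k x)]
    exact hg1 k x
  have hg2 (k : ℕ) : MemLp (g k) 2 m :=
    MemLp.of_bound (hg k).aestronglyMeasurable 1 (Eventually.of_forall (hgb k))
  obtain ⟨h₀, hh₀⟩ := exists_tendsto_inner_ultrafilter U (x := fun k => (hg2 k).toLp (g k))
    (C := m.real univ ^ ((2 : ℝ≥0∞).toReal)⁻¹ * 1) (fun k =>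
      Lp.norm_le_of_ae_bound zero_le_one (by
        filter_upwards [(hg2 k).coeFn_toLp] with x hx
        rw [hx]
        exact hgb k x))
  have hset (A : Set X) (hA : MeasurableSet A) :
      Tendsto (fun k => ∫ x in A, g k x ∂m) U (𝓝 (∫ x in A, h₀ x ∂m)) := by
    have h1 := hh₀ (indicatorConstLp 2 hA (measure_ne_top m A) (1 : ℝ))
    have e (u : Lp ℝ 2 m) : inner ℝ u (indicatorConstLp 2 hA (measure_ne_top m A) (1 : ℝ)) =
        ∫ x in A, u x ∂m := by
      rw [real_inner_comm, L2.inner_indicatorConstLp_one]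
    simp only [e] at h1
    refine h1.congr fun k => ?_
    exact integral_congr_ae (ae_restrict_of_ae (hg2 k).coeFn_toLp)
  have hh₀i : Integrable h₀ m := (Lp.memLp h₀).integrable (by norm_num)
  have h0 : 0 ≤ᵐ[m] h₀ := ae_nonneg_of_forall_setIntegral_nonneg hh₀i fun A hA _ =>
    ge_of_tendsto' (hset A hA) fun k => integral_nonneg (hg0 k)
  have h1 : h₀ ≤ᵐ[m] fun _ => 1 := by
    refine ae_le_of_forall_setIntegral_le hh₀i (integrable_const 1) fun A hA _ => ?_
    refine le_of_tendsto' (hset A hA) fun k => ?_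
    refine integral_mono_of_nonneg (Eventually.of_forall (hg0 k)) (integrable_const 1)
      (Eventually.of_forall (hg1 k))
  -- Truncation changes $h_0$ only on a null set and makes the bounds hold everywhere.
  let h : X → ℝ := fun x => max 0 (min (h₀ x) 1)
  have hh : h =ᵐ[m] h₀ := by
    filter_upwards [h0, h1] with x hx0 hx1
    simp only [h]
    rw [min_eq_left hx1, max_eq_right (show (0 : ℝ) ≤ h₀ x from hx0)]
  have hhm : Measurable h :=
    measurable_const.max ((Lp.stronglyMeasurable h₀).measurable.min measurable_const)
  have hh0 : ∀ x, 0 ≤ h x := fun x => le_max_left _ _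
  have hh1 : ∀ x, h x ≤ 1 := fun x => max_le zero_le_one (min_le_right _ _)
  refine ⟨h, hhm, hh0, hh1, fun ψ hψ => ?_⟩
  refine Integrable.induction (P := fun ψ =>
    Tendsto (fun k => ∫ x, g k x * ψ x ∂m) U (𝓝 (∫ x, h x * ψ x ∂m))) ?_ ?_ ?_ ?_ hψ
  · intro c A hA _
    have e (u : X → ℝ) : ∫ x, u x * A.indicator (fun _ => c) x ∂m = (∫ x in A, u x ∂m) * c := by
      rw [← integral_mul_const, ← integral_indicator hA]
      congr 1 with x
      by_cases hx : x ∈ A <;> simp [hx]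
    simp only [e]
    rw [integral_congr_ae (ae_restrict_of_ae hh)]
    exact (hset A hA).mul_const c
  · intro ψ ψ' _ hψ hψ' t t'
    have e (u : X → ℝ) (hu : Measurable u) (hu0 : ∀ x, 0 ≤ u x) (hu1 : ∀ x, u x ≤ 1) :
        ∫ x, u x * (ψ + ψ') x ∂m = (∫ x, u x * ψ x ∂m) + ∫ x, u x * ψ' x ∂m := by
      rw [← integral_add (integrable_mul_of_unit_bound hu hu0 hu1 hψ)
        (integrable_mul_of_unit_bound hu hu0 hu1 hψ')]
      simp [mul_add]
    rw [e h hhm hh0 hh1]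
    exact (t.add t').congr fun k => (e _ (hg k) (hg0 k) (hg1 k)).symm
  · refine isClosed_of_closure_subset fun ψ hψ => ?_
    simp only [mem_ofPred_eq]
    rw [Metric.tendsto_nhds]
    intro δ hδ
    obtain ⟨ψ', hψ', hd⟩ := Metric.mem_closure_iff.1 hψ (δ / 3) (by positivity)
    have hd' : ∫ x, |ψ x - ψ' x| ∂m < δ / 3 := by
      rw [L1.dist_eq_integral_dist] at hd
      exact hd
    filter_upwards [(Metric.tendsto_nhds.1 hψ') (δ / 3) (by positivity)] with k hk
    have i1 := L1.integrable_coeFn ψ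
    have i2 := L1.integrable_coeFn ψ'
    have b1 := abs_integral_mul_sub_le (hg k) (hg0 k) (hg1 k) i1 i2
    have b2 := abs_integral_mul_sub_le hhm hh0 hh1 i1 i2
    rw [Real.dist_eq] at hk ⊢
    rw [abs_le] at b1 b2
    rw [abs_lt] at hk ⊢
    constructor <;> linarith [b1.1, b1.2, b2.1, b2.2, hk.1, hk.2]
  · intro ψ ψ' hψψ' _ t
    have e (u : X → ℝ) : ∫ x, u x * ψ x ∂m = ∫ x, u x * ψ' x ∂m :=
      integral_congr_ae (by filter_upwards [hψψ'] with x hx; rw [hx])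
    simpa only [e] using t

/-- A weak limit agrees almost everywhere with the pointwise limit where the latter exists. -/
theorem ae_eq_of_tendsto_of_weak_limit {U : Ultrafilter ℕ} (hU : (U : Filter ℕ) ≤ atTop)
    {g : ℕ → X → ℝ} (hg : ∀ k, Measurable (g k))
    (hg0 : ∀ k x, 0 ≤ g k x) (hg1 : ∀ k x, g k x ≤ 1) {h : X → ℝ} (hh : Integrable h m)
    (hlim : ∀ ψ, Integrable ψ m →
      Tendsto (fun k => ∫ x, g k x * ψ x ∂m) U (𝓝 (∫ x, h x * ψ x ∂m))) :
    ∀ᵐ x ∂m, ∀ l, Tendsto (fun k => g k x) atTop (𝓝 l) → h x = l := by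
  classical
  let S : Set X := {x | ∃ l, Tendsto (fun k => g k x) atTop (𝓝 l)}
  have hS : MeasurableSet S := measurableSet_exists_tendsto hg
  let G : X → ℝ := fun x => if hx : x ∈ S then hx.choose else 0
  have hG : ∀ x, Tendsto (fun k => S.indicator (g k) x) atTop (𝓝 (G x)) := by
    intro x
    by_cases hx : x ∈ S
    · simp only [G, dif_pos hx, indicator_of_mem hx]
      exact hx.choose_spec
    · simp only [G, dif_neg hx, indicator_of_notMem hx]
      exact tendsto_const_nhds
  have hb (k : ℕ) (x : X) : ‖S.indicator (g k) x‖ ≤ 1 := by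
    by_cases hx : x ∈ S
    · rw [indicator_of_mem hx, Real.norm_of_nonneg (hg0 k x)]
      exact hg1 k x
    · rw [indicator_of_notMem hx]
      simp
  have hGm : Measurable G := measurable_of_tendsto_metrizable (fun k => (hg k).indicator hS)
    (tendsto_pi_nhds.2 hG)
  have hGi : Integrable G m := Integrable.of_bound hGm.aestronglyMeasurable 1
    (Eventually.of_forall fun x => le_of_tendsto' (hG x).norm fun k => hb k x)
  have key : G =ᵐ[m] S.indicator h := by
    refine Integrable.ae_eq_of_forall_setIntegral_eq _ _ hGi (hh.indicator hS) fun A hA _ => ?_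
    have t1 : Tendsto (fun k => ∫ x in A, S.indicator (g k) x ∂m) atTop (𝓝 (∫ x in A, G x ∂m)) :=
      tendsto_integral_of_dominated_convergence (fun _ => 1)
        (fun k => ((hg k).indicator hS).aestronglyMeasurable) (integrable_const 1)
        (fun k => Eventually.of_forall (hb k)) (Eventually.of_forall hG)
    -- On the convergence set $S$, dominated convergence and weak convergence compute the same limit
    -- of $\int_{A\cap S}g_k$.
    have t2 := hlim ((A ∩ S).indicator fun _ => 1)
      ((integrable_const (1 : ℝ)).indicator (hA.inter hS))
    have e (u : X → ℝ) : ∫ x, u x * (A ∩ S).indicator (fun _ => (1 : ℝ)) x ∂m =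
        ∫ x in A, S.indicator u x ∂m := by
      rw [← integral_indicator hA]
      congr 1 with x
      by_cases hx : x ∈ A <;> by_cases hx' : x ∈ S <;> simp [hx, hx']
    simp only [e] at t2
    exact tendsto_nhds_unique (t1.mono_left hU) t2
  filter_upwards [key] with x hx l hl
  have hxS : x ∈ S := ⟨l, hl⟩
  have t := hG x
  simp only [indicator_of_mem hxS] at t
  rw [indicator_of_mem hxS] at hx
  rw [← hx]
  exact tendsto_nhds_unique t hl

end WeakLimit

/-! ### The non-local fractional gradient -/

section NonLocal

variable {n : ℕ} {α : ℝ} {f : Rn n → ℝ}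

theorem norm_sub_le_two {g : Rn n → ℝ} (hg1 : ∀ x, ‖g x‖ ≤ 1) (x y : Rn n) : ‖g y - g x‖ ≤ 2 :=
  (norm_sub_le _ _).trans (by linarith [hg1 x, hg1 y])

theorem aestronglyMeasurable_difference {g : Rn n → ℝ} (hg : AEStronglyMeasurable g) :
    AEStronglyMeasurable (fun p : Rn n × Rn n => g p.2 - g p.1) (volume.prod volume) :=
  hg.comp_snd.sub hg.comp_fst

theorem IsTest.integrable_mul_inner_prod {φ : Rn n → Rn n} (hφ : IsTest φ) (hn : 1 ≤ n)
    (hα0 : 0 < α) (hα1 : α < 1) {w : Rn n × Rn n → ℝ} {M : ℝ}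
    (hw : AEStronglyMeasurable w (volume.prod volume)) (hM : ∀ p, ‖w p‖ ≤ M) :
    Integrable (fun p => w p * inner ℝ (φ p.2 - φ p.1) (kernel n α (p.2 - p.1)))
      (volume.prod volume) := by
  obtain ⟨C, _, hC⟩ := exists_boundedLipschitz hφ.1 hφ.2
  exact (hC.integrable_inner_prod hφ.2 hn hα0 hα1).bdd_mul hw (Eventually.of_forall hM)

theorem integral_mul_integral_inner {φ : Rn n → Rn n} (hφ : IsTest φ) (hn : 1 ≤ n)
    (hα0 : 0 < α) (hα1 : α < 1) (hf : AEStronglyMeasurable f) (hf1 : ∀ x, ‖f x‖ ≤ 1)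
    {w : Rn n × Rn n → ℝ} {M : ℝ} (hw : AEStronglyMeasurable w (volume.prod volume))
    (hM : ∀ p, ‖w p‖ ≤ M) (c : ℝ) :
    ∫ x, f x * (c * ∫ y, w (x, y) * inner ℝ (φ y - φ x) (kernel n α (y - x))) =
      c * ∫ p, f p.1 * (w p * inner ℝ (φ p.2 - φ p.1) (kernel n α (p.2 - p.1)))
        ∂(volume.prod volume) := by
  have h := (hφ.integrable_mul_inner_prod hn hα0 hα1 hw hM).bdd_mul (hf.comp_fst (ν := volume))
    (Eventually.of_forall fun p => hf1 p.1)
  rw [integral_prod _ h, ← integral_const_mul]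
  congr 1 with x
  simp only [integral_const_mul]
  ring

theorem integral_mul_fracDivNL_eq {φ : Rn n → Rn n} (hφ : IsTest φ) (hn : 1 ≤ n)
    (hα0 : 0 < α) (hα1 : α < 1) (hf : AEStronglyMeasurable f) (hf1 : ∀ x, ‖f x‖ ≤ 1)
    {g : Rn n → ℝ} (hg : AEStronglyMeasurable g) (hg1 : ∀ x, ‖g x‖ ≤ 1) :
    ∫ x, f x * fracDivNL α g φ x = muConst n α * ∫ p, f p.1 * ((g p.2 - g p.1) *
      inner ℝ (φ p.2 - φ p.1) (kernel n α (p.2 - p.1))) ∂(volume.prod volume) := by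
  simp only [fracDivNL_eq]
  exact integral_mul_integral_inner hφ hn hα0 hα1 hf hf1 (aestronglyMeasurable_difference hg)
    (fun p => norm_sub_le_two hg1 p.1 p.2) (muConst n α)

theorem IsTest.integrable_fracDivNL {φ : Rn n → Rn n} (hφ : IsTest φ) (hn : 1 ≤ n)
    (hα0 : 0 < α) (hα1 : α < 1) {g : Rn n → ℝ} (hg : AEStronglyMeasurable g)
    (hg1 : ∀ x, ‖g x‖ ≤ 1) : Integrable (fracDivNL α g φ) := by
  have := (hφ.integrable_mul_inner_prod hn hα0 hα1 (aestronglyMeasurable_difference hg)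
    (fun p => norm_sub_le_two hg1 p.1 p.2)).integral_prod_left
  exact (this.const_mul (muConst n α)).congr
    (Eventually.of_forall fun x => (fracDivNL_eq g φ x).symm)

/-- As a double integral the expression is dominated by twice the integrable kernel term of
$\varphi$, so a.e. convergence of bounded $G_k$ is enough. -/
theorem tendsto_integral_mul_fracDivNL {φ : Rn n → Rn n} (hφ : IsTest φ) (hn : 1 ≤ n)
    (hα0 : 0 < α) (hα1 : α < 1) (hf : AEStronglyMeasurable f) (hf1 : ∀ x, ‖f x‖ ≤ 1)
    {g : Rn n → ℝ} {G : ℕ → Rn n → ℝ} (hG : ∀ k, AEStronglyMeasurable (G k))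
    (hG1 : ∀ k x, ‖G k x‖ ≤ 1) (hg : AEStronglyMeasurable g) (hg1 : ∀ x, ‖g x‖ ≤ 1)
    (hlim : ∀ᵐ x, Tendsto (fun k => G k x) atTop (𝓝 (g x))) :
    Tendsto (fun k => ∫ x, f x * fracDivNL α (G k) φ x) atTop
      (𝓝 (∫ x, f x * fracDivNL α g φ x)) := by
  rw [integral_mul_fracDivNL_eq hφ hn hα0 hα1 hf hf1 hg hg1]
  simp only [fun k => integral_mul_fracDivNL_eq hφ hn hα0 hα1 hf hf1 (hG k) (hG1 k)]
  refine Tendsto.const_mul _ ?_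
  obtain ⟨C, _, hC⟩ := exists_boundedLipschitz hφ.1 hφ.2
  have hI := hC.integrable_inner_prod hφ.2 hn hα0 hα1
  refine tendsto_integral_of_dominated_convergence
    (fun p => 2 * ‖inner ℝ (φ p.2 - φ p.1) (kernel n α (p.2 - p.1))‖)
    (fun k => hf.comp_fst.mul ((aestronglyMeasurable_difference (hG k)).mul hI.1))
    (hI.norm.const_mul 2) (fun k => Eventually.of_forall fun p => ?_) ?_
  · rw [norm_mul, norm_mul]
    refine (mul_le_of_le_one_left (by positivity) (hf1 _)).trans ?_
    exact mul_le_mul_of_nonneg_right (norm_sub_le_two (hG1 k) _ _) (norm_nonneg _)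
  · filter_upwards [Measure.quasiMeasurePreserving_fst.ae hlim,
      Measure.quasiMeasurePreserving_snd.ae hlim] with p h1 h2
    exact ((h2.sub h1).mul_const _).const_mul _

variable {ρ : Rn n → ℝ} {ε : ℝ}

theorem IsMollifier.isTest_mollify_smul (hρ : IsMollifier ρ ε) (hf : AEStronglyMeasurable f)
    (hf1 : ∀ x, ‖f x‖ ≤ 1) {φ : Rn n → Rn n} (hφ : IsTest φ) :
    IsTest fun x => mollify ρ f x • φ x :=
  ⟨(hρ.contDiff_mollify hf hf1).fun_smul hφ.1, hφ.2.smul_left (f := mollify ρ f)⟩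

/-- The Leibniz rule for the fractional divergence of `(ρ * f) φ`, at a point. -/
theorem IsMollifier.fracDiv_mollify_smul (hρ : IsMollifier ρ ε) (hn : 1 ≤ n) (hα0 : 0 < α)
    (hα1 : α < 1) (hf : AEStronglyMeasurable f) (hf1 : ∀ x, ‖f x‖ ≤ 1) {φ : Rn n → Rn n}
    (hφ : IsTest φ) (x : Rn n) :
    fracDiv α (fun y => mollify ρ f y • φ y) x =
      mollify ρ f x * fracDiv α φ x + inner ℝ (φ x) (muConst n α • mollGrad α ρ f x) +
        fracDivNL α (mollify ρ f) φ x := by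
  set g := mollify ρ f with hg
  have hg1 : ∀ x, ‖g x‖ ≤ 1 := hρ.norm_mollify_le hf hf1
  have hgc : Continuous g := (hρ.contDiff_mollify hf hf1).continuous
  have hgφ := hρ.isTest_mollify_smul hf hf1 hφ
  obtain ⟨C, _, hC⟩ := exists_boundedLipschitz hφ.1 hφ.2
  obtain ⟨C', _, hC'⟩ := exists_boundedLipschitz hgφ.1 hgφ.2
  have i1 := hC'.integrable_inner hn hα0 hα1 x
  have i2 := hC.integrable_inner hn hα0 hα1 x
  have i3 : Integrable fun y => (g y - g x) * inner ℝ (φ y - φ x) (kernel n α (y - x)) :=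
    i2.bdd_mul (hgc.sub continuous_const).aestronglyMeasurable
      (Eventually.of_forall fun y => norm_sub_le_two hg1 x y)
  have h := hρ.integral_mollify_mul_inner hn hα0 hα1 hf hf1 x (φ x)
  -- From $g(y)\varphi(y)-g(x)\varphi(x)=g(x)\Delta\varphi+\Delta g\,\varphi(x)+\Delta
  -- g\,\Delta\varphi$, with $\Delta$ the difference between $y$ and $x$.
  have e : ∫ y, (g y - g x) * inner ℝ (φ x) (kernel n α (y - x)) =
      (∫ y, inner ℝ (g y • φ y - g x • φ x) (kernel n α (y - x))) -
        g x * (∫ y, inner ℝ (φ y - φ x) (kernel n α (y - x))) -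
        ∫ y, (g y - g x) * inner ℝ (φ y - φ x) (kernel n α (y - x)) := by
    rw [← integral_const_mul, ← integral_sub i1 (i2.const_mul _), ← integral_sub _ i3]
    · congr 1 with y
      simp only [inner_sub_left, inner_smul_left, conj_trivial]
      ring
    · exact i1.sub (i2.const_mul _)
  rw [e] at h
  rw [fracDiv_eq, fracDiv_eq, fracDivNL_eq, inner_smul_right, ← h]
  ring

/-- The Leibniz rule for the fractional divergence of `(ρ * f) φ`, integrated against `f`. -/
theorem IsMollifier.fracPairing_mollify_smul (hρ : IsMollifier ρ ε) (hn : 1 ≤ n) (hα0 : 0 < α)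
    (hα1 : α < 1) (hf : AEStronglyMeasurable f) (hf1 : ∀ x, ‖f x‖ ≤ 1) {φ : Rn n → Rn n}
    (hφ : IsTest φ) :
    fracPairing α f (fun y => mollify ρ f y • φ y) =
      (∫ x, f x * (mollify ρ f x * fracDiv α φ x)) -
        fracPairing α f (mollify ρ fun y => f y • φ y) +
        ∫ x, f x * fracDivNL α (mollify ρ f) φ x := by
  have hg1 : ∀ x, ‖mollify ρ f x‖ ≤ 1 := hρ.norm_mollify_le hf hf1
  have hgm : AEStronglyMeasurable (mollify ρ f) :=
    (hρ.contDiff_mollify hf hf1).continuous.aestronglyMeasurable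
  have hφi : Integrable φ := hφ.1.continuous.integrable_of_hasCompactSupport hφ.2
  obtain ⟨M, hM⟩ := hφ.1.continuous.bounded_above_of_compact_support hφ.2
  have hfφ : Integrable fun x => f x • φ x := hφi.bdd_smul 1 hf (Eventually.of_forall hf1)
  have hfφM (x : Rn n) : ‖f x • φ x‖ ≤ M := by
    rw [norm_smul]
    exact (mul_le_of_le_one_left (norm_nonneg _) (hf1 x)).trans (hM x)
  have i1 : Integrable fun x => f x * (mollify ρ f x * fracDiv α φ x) :=
    integrable_bounded_mul hf hf1
      (integrable_bounded_mul hgm hg1 (hφ.integrable_fracDiv hn hα0 hα1))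
  have i3 := integrable_bounded_mul hf hf1 (hφ.integrable_fracDivNL hn hα0 hα1 hgm hg1)
  have i2 : Integrable fun x => inner ℝ (f x • φ x) (muConst n α • mollGrad α ρ f x) := by
    have hu := (hρ.aestronglyMeasurable_mollGrad hn hα0 hα1 hf).const_smul (muConst n α)
    refine (hfφ.norm.mul_const (‖muConst n α‖ * ∫ z, ‖gradKernel α ρ z‖)).mono'
      (hfφ.1.inner hu) (Eventually.of_forall fun x => (norm_inner_le_norm _ _).trans ?_)
    rw [norm_smul (muConst n α)]
    gcongr
    exact hρ.norm_mollGrad_le hn hα0 hα1 hf1 x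
  rw [hρ.fracPairing_mollify hn hα0 hα1 hf hf1 hfφ hfφM, sub_neg_eq_add, ← integral_add i1 i2,
    ← integral_add _ i3, fracPairing]
  · congr 1 with x
    rw [hρ.fracDiv_mollify_smul hn hα0 hα1 hf hf1 hφ, inner_smul_left, conj_trivial]
    ring
  · exact i1.add i2

theorem integrable_inner_of_integrableOn_ball {m : Measure (Rn n)} {σ φ : Rn n → Rn n}
    (hσ : ∀ R, IntegrableOn σ (Metric.ball 0 R) m) (hφ : Continuous φ)
    (hc : HasCompactSupport φ) : Integrable (fun x => inner ℝ (φ x) (σ x)) m := by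
  obtain ⟨R, hR⟩ := exists_tsupport_subset_ball hc
  obtain ⟨M, hM⟩ := hφ.bounded_above_of_compact_support hc
  refine (integrableOn_iff_integrable_of_support_subset (s := Metric.ball 0 R) fun x hx => ?_).1
    (((hσ R).norm.const_mul M).mono' (hφ.aestronglyMeasurable.inner (hσ R).1)
      (Eventually.of_forall fun x => (norm_inner_le_norm _ _).trans
        (mul_le_mul_of_nonneg_right (hM x) (norm_nonneg _))))
  by_contra h
  refine hx ?_
  simp only [image_eq_zero_of_notMem_tsupport fun h' => h (hR h'), inner_zero_left]

/-- The commutator of mollification and multiplication by `f` is negligible in the limit. -/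
theorem tendsto_integral_inner_mollify_smul_sub {m : Measure (Rn n)} {σ : Rn n → Rn n}
    (hσ : ∀ R, IntegrableOn σ (Metric.ball 0 R) m) (hf : AEStronglyMeasurable f)
    (hf1 : ∀ x, ‖f x‖ ≤ 1) {ρ : ℕ → Rn n → ℝ} {ε : ℕ → ℝ} (hρ : ∀ k, IsMollifier (ρ k) (ε k))
    (hε1 : ∀ k, ε k ≤ 1) (hε : Tendsto ε atTop (𝓝 0)) {φ : Rn n → Rn n} (hφ : IsTest φ) :
    Tendsto (fun k => (∫ x, inner ℝ (mollify (ρ k) (fun z => f z • φ z) x) (σ x) ∂m) -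
      ∫ x, inner ℝ (mollify (ρ k) f x • φ x) (σ x) ∂m) atTop (𝓝 0) := by
  obtain ⟨C, hC0, hC⟩ := exists_boundedLipschitz hφ.1 hφ.2
  obtain ⟨M, hM⟩ := hφ.1.continuous.bounded_above_of_compact_support hφ.2
  obtain ⟨R, hR⟩ := exists_tsupport_subset_ball hφ.2
  have hφR : ∀ x, R ≤ ‖x‖ → φ x = 0 := fun x hx =>
    image_eq_zero_of_notMem_tsupport fun h => by
      have := hR h
      simp at this
      linarith
  have hfφR : ∀ x, R ≤ ‖x‖ → f x • φ x = 0 := fun x hx => by rw [hφR x hx, smul_zero]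
  have hfφ : AEStronglyMeasurable fun x => f x • φ x :=
    hf.smul hφ.1.continuous.aestronglyMeasurable
  have hfφM (x : Rn n) : ‖f x • φ x‖ ≤ M := by
    rw [norm_smul]
    exact (mul_le_of_le_one_left (norm_nonneg _) (hf1 x)).trans (hM x)
  refine squeeze_zero_norm (a := fun k => C * ε k * ∫ x in Metric.ball 0 (R + 2), ‖σ x‖ ∂m)
    (fun k => ?_) ?_
  · have t1 := (hρ k).isTest_mollify hfφ hfφM hfφR
    have t2 := (hρ k).isTest_mollify_smul hf hf1 hφ
    rw [← integral_sub (integrable_inner_of_integrableOn_ball hσ t1.1.continuous t1.2)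
      (integrable_inner_of_integrableOn_ball hσ t2.1.continuous t2.2), ← integral_const_mul,
      ← setIntegral_eq_integral_of_forall_compl_eq_zero (s := Metric.ball 0 (R + 2))]
    · refine norm_integral_le_of_norm_le ((hσ (R + 2)).norm.const_mul _)
        (Eventually.of_forall fun x => ?_)
      rw [← inner_sub_left]
      exact (norm_inner_le_norm _ _).trans (mul_le_mul_of_nonneg_right
        ((hρ k).norm_mollify_smul_sub_le hf hf1 hC hC0 hM x) (norm_nonneg _))
    · intro x hx
      have h1 : mollify (ρ k) (fun z => f z • φ z) x = 0 :=
        image_eq_zero_of_notMem_tsupport fun h =>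
          hx ((hρ k).tsupport_mollify_subset hfφR (by linarith [hε1 k]) h)
      have h2 : φ x = 0 := hφR x (by
        have : R + 2 ≤ ‖x‖ := by simpa using hx
        linarith)
      rw [h1, h2, smul_zero, inner_zero_left, sub_zero]
  · simpa using (hε.const_mul C).mul_const (∫ x in Metric.ball 0 (R + 2), ‖σ x‖ ∂m)

/-- The densities of the fractional variation and of the non-local gradient of a function with
values in `{0, 1}`. -/
theorem exists_density_nonlocal (hn : 1 ≤ n) (hα0 : 0 < α) (hα1 : α < 1) {p : ℝ≥0∞}
    (hBV : MemBVloc α p f) (hf : AEStronglyMeasurable f) (hf0 : ∀ x, 0 ≤ f x)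
    (hf1 : ∀ x, ‖f x‖ ≤ 1) (hff : ∀ x, f x * f x = f x) :
    ∃ (m : Measure (Rn n)) (_ : IsFiniteMeasure m) (σ : Rn n → Rn n) (h : Rn n → ℝ),
      Measurable σ ∧ (∀ R, IntegrableOn σ (Metric.ball 0 R) m) ∧
      Measurable h ∧ (∀ x, 0 ≤ h x) ∧ (∀ x, h x ≤ 1) ∧
      (∀ φ : Rn n → Rn n, IsTest φ → fracPairing α f φ = -∫ x, inner ℝ (φ x) (σ x) ∂m) ∧
      (∀ φ : Rn n → Rn n, IsTest φ → ∫ x, f x * fracDivNL α f φ x =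
        ∫ x, inner ℝ (φ x) ((1 - 2 * h x) • σ x) ∂m) ∧
      ∀ᵐ x ∂m, ∀ l, Tendsto (fun r : ℝ => ⨍ y in Metric.ball x r, f y) (𝓝[>] 0) (𝓝 l) →
        h x = l := by
  obtain ⟨m, hm, σ, hσ, hσR, hD⟩ := exists_density_fracVariation hn hα0 hα1 hBV hf hf1
  let ε : ℕ → ℝ := fun k => 1 / ((k : ℝ) + 1)
  have hε0 (k) : 0 < ε k := Nat.one_div_pos_of_nat
  have hε1 (k) : ε k ≤ 1 := by
    simp only [ε]
    rw [div_le_one (by positivity)]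
    linarith [(Nat.cast_nonneg k : (0 : ℝ) ≤ k)]
  have hε : Tendsto ε atTop (𝓝 0) := tendsto_one_div_add_atTop_nhds_zero_nat
  have hε' : Tendsto ε atTop (𝓝[>] 0) :=
    tendsto_nhdsWithin_iff.2 ⟨hε, Eventually.of_forall hε0⟩
  let ρ : ℕ → Rn n → ℝ := fun k => radialMollifier n (ε k)
  have hρ (k) : IsMollifier (ρ k) (ε k) := isMollifier_radialMollifier (n := n) (hε0 k)
  let g : ℕ → Rn n → ℝ := fun k => mollify (ρ k) f
  have hgc (k) : Continuous (g k) := ((hρ k).contDiff_mollify hf hf1).continuous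
  have hgn (k) (x) : ‖g k x‖ ≤ 1 := (hρ k).norm_mollify_le hf hf1 x
  have hg0 (k) (x) : 0 ≤ g k x := (hρ k).mollify_nonneg hf0 x
  have hg1 (k) (x) : g k x ≤ 1 := (le_abs_self _).trans (hgn k x)
  have hgl {x : Rn n} {l : ℝ}
      (hl : Tendsto (fun r : ℝ => ⨍ y in Metric.ball x r, f y) (𝓝[>] 0) (𝓝 l)) :
      Tendsto (fun k => g k x) atTop (𝓝 l) :=
    (tendsto_mollify_of_tendsto_average hf hf1 hl).comp hε'
  have hgf : ∀ᵐ x, Tendsto (fun k => g k x) atTop (𝓝 (f x)) := by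
    filter_upwards [ae_tendsto_average_ball hf hf1] with x hx using hgl hx
  obtain ⟨h, hh, hh0, hh1, hlim⟩ := exists_weak_limit (m := m) (hyperfilter ℕ)
    (fun k => (hgc k).measurable) hg0 hg1
  have hU := Nat.hyperfilter_le_atTop
  have hhi : Integrable h m := Integrable.of_bound hh.aestronglyMeasurable 1
    (Eventually.of_forall fun x => by rw [Real.norm_of_nonneg (hh0 x)]; exact hh1 x)
  refine ⟨m, hm, σ, h, hσ, hσR, hh, hh0, hh1, hD, fun φ hφ => ?_, ?_⟩
  · have hφσ := integrable_inner_of_integrableOn_ball hσR hφ.1.continuous hφ.2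
    have hdiv := hφ.integrable_fracDiv (n := n) hn hα0 hα1
    have t1 := hlim _ hφσ
    have t2 : Tendsto (fun k => ∫ x, f x * (g k x * fracDiv α φ x)) (hyperfilter ℕ)
        (𝓝 (fracPairing α f φ)) := by
      refine Tendsto.mono_left ?_ hU
      -- Idempotence enters here: $f g_k\to f^2=f$.
      have e : fracPairing α f φ = ∫ x, f x * (f x * fracDiv α φ x) := by
        rw [fracPairing]
        congr 1 with x
        rw [← mul_assoc, hff]
      rw [e]
      refine tendsto_integral_of_dominated_convergence (fun x => ‖fracDiv α φ x‖)
        (fun k => hf.mul ((hgc k).aestronglyMeasurable.mul hdiv.1)) hdiv.norm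
        (fun k => Eventually.of_forall fun x => ?_) ?_
      · rw [norm_mul, norm_mul]
        exact (mul_le_of_le_one_left (by positivity) (hf1 x)).trans
          (mul_le_of_le_one_left (norm_nonneg _) (hgn k x))
      · filter_upwards [hgf] with x hx using (hx.mul_const _).const_mul _
    have t3 := (tendsto_integral_mul_fracDivNL hφ hn hα0 hα1 hf hf1
      (fun k => (hgc k).aestronglyMeasurable) hgn hf hf1 hgf).mono_left hU
    have t4 := (tendsto_integral_inner_mollify_smul_sub hσR hf hf1 hρ hε1 hε hφ).mono_left hU
    -- The integrated Leibniz rule with both pairings written through $\sigma$. Trading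
    -- $\rho_k*(f\varphi)$ for $g_k\varphi$ costs the commutator and yields the factor $2$.
    have hL (k : ℕ) : ∫ x, f x * fracDivNL α (g k) φ x =
        -(∫ x, f x * (g k x * fracDiv α φ x)) -
          ((∫ x, inner ℝ (mollify (ρ k) (fun z => f z • φ z) x) (σ x) ∂m) -
            ∫ x, inner ℝ (mollify (ρ k) f x • φ x) (σ x) ∂m) -
          2 * ∫ x, g k x * inner ℝ (φ x) (σ x) ∂m := by
      obtain ⟨M, hM⟩ := hφ.1.continuous.bounded_above_of_compact_support hφ.2
      obtain ⟨R, hR⟩ := exists_tsupport_subset_ball hφ.2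
      have hfφ : IsTest (mollify (ρ k) fun z => f z • φ z) :=
        (hρ k).isTest_mollify (M := M) (R := R)
          (hf.smul hφ.1.continuous.aestronglyMeasurable) (fun x => by
            rw [norm_smul]
            exact (mul_le_of_le_one_left (norm_nonneg _) (hf1 x)).trans (hM x))
          (fun x hx => by
            have h0 : φ x = 0 := image_eq_zero_of_notMem_tsupport fun h => by
              have := hR h
              simp at this
              linarith
            rw [h0, smul_zero])
      have := (hρ k).fracPairing_mollify_smul hn hα0 hα1 hf hf1 hφ
      rw [hD _ hfφ, hD _ ((hρ k).isTest_mollify_smul hf hf1 hφ)] at this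
      have e : ∫ x, inner ℝ (mollify (ρ k) f x • φ x) (σ x) ∂m =
          ∫ x, g k x * inner ℝ (φ x) (σ x) ∂m := by
        congr 1 with x
        rw [inner_smul_left, conj_trivial]
      simp only [g] at e ⊢
      linarith
    have t5 := (t2.neg.sub t4).sub (t1.const_mul 2)
    rw [tendsto_nhds_unique t3 (t5.congr fun k => (hL k).symm), hD φ hφ]
    have i2 : Integrable (fun x => h x * inner ℝ (φ x) (σ x)) m :=
      integrable_mul_of_unit_bound hh hh0 hh1 hφσ
    rw [neg_neg, sub_zero, ← integral_const_mul, ← integral_sub hφσ (i2.const_mul 2)]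
    congr 1 with x
    rw [inner_smul_right]
    ring
  · filter_upwards [ae_eq_of_tendsto_of_weak_limit hU (fun k => (hgc k).measurable) hg0 hg1 hhi
      hlim] with x hx l hl using hx l (hgl hl)

end NonLocal

/-! ### Finite total variation -/

section Global

variable {n : ℕ} {α : ℝ} {f : Rn n → ℝ}

/-- Smooth cutoff functions converging to `1`, with uniform Lipschitz bounds. -/
theorem exists_cutoff (n : ℕ) : ∃ (C : ℝ) (η : ℕ → Rn n → ℝ), 0 ≤ C ∧
    (∀ k, ContDiff ℝ ∞ (η k)) ∧ (∀ k, HasCompactSupport (η k)) ∧ (∀ k x, ‖η k x‖ ≤ 1) ∧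
    (∀ k, BoundedLipschitz C (η k)) ∧ ∀ x, Tendsto (fun k => η k x) atTop (𝓝 1) := by
  -- Dilations $b(t_kx)$ with $t_k\le1$ keep the constant $C$ of $b$ and tend to $b(0)=1$.
  let b : ContDiffBump (0 : Rn n) := ⟨1, 2, zero_lt_one, one_lt_two⟩
  have hb : ContDiff ℝ ∞ b := b.contDiff
  obtain ⟨C, hC0, hC⟩ := exists_boundedLipschitz hb b.hasCompactSupport
  let t : ℕ → ℝ := fun k => 1 / ((k : ℝ) + 1)
  have ht0 (k) : 0 < t k := Nat.one_div_pos_of_nat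
  have ht1 (k) : t k ≤ 1 := by
    simp only [t]
    rw [div_le_one (by positivity)]
    linarith [(Nat.cast_nonneg k : (0 : ℝ) ≤ k)]
  have ht : Tendsto t atTop (𝓝 0) := tendsto_one_div_add_atTop_nhds_zero_nat
  refine ⟨C, fun k x => b (t k • x), hC0, fun k => hb.comp (contDiff_const_smul _), fun k => ?_,
    fun k x => ?_, fun k => ⟨hC.1.comp (continuous_const_smul _), fun x y => ?_⟩, fun x => ?_⟩
  · exact b.hasCompactSupport.comp_smul (ht0 k).ne'
  · rw [Real.norm_of_nonneg b.nonneg]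
    exact b.le_one
  · refine (hC.2 _ _).trans (mul_le_mul_of_nonneg_left (min_le_min_right _ ?_) hC0)
    rw [← smul_sub, norm_smul, Real.norm_of_nonneg (ht0 k).le]
    exact mul_le_of_le_one_left (norm_nonneg _) (ht1 k)
  · have h1 : Tendsto (fun k => t k • x) atTop (𝓝 0) := by simpa using ht.smul_const x
    have h2 := (hC.1.tendsto 0).comp h1
    rwa [b.one_of_mem_closedBall (by simp [b.rIn_pos.le])] at h2

theorem BoundedLipschitz.smul_const {C : ℝ} {η : Rn n → ℝ} (hη : BoundedLipschitz C η)
    (e : Rn n) : BoundedLipschitz (C * ‖e‖) fun x => η x • e := by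
  refine ⟨hη.1.smul continuous_const, fun x y => ?_⟩
  rw [← sub_smul, norm_smul, mul_right_comm]
  exact mul_le_mul_of_nonneg_right (hη.2 x y) (norm_nonneg _)

/-- The differences tend to $e-e=0$ pointwise. The uniform constant $C$ and $f\in L^1$ supply the
dominating function; boundedness of $f$ alone would not. -/
theorem tendsto_integral_mul_inner_cutoff (hn : 1 ≤ n) (hα0 : 0 < α) (hα1 : α < 1)
    (hf : Integrable f) {w : Rn n × Rn n → ℝ} {M : ℝ}
    (hw : AEStronglyMeasurable w (volume.prod volume)) (hM : ∀ p, ‖w p‖ ≤ M)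
    {C : ℝ} {φ : ℕ → Rn n → Rn n} (hφ : ∀ k, BoundedLipschitz C (φ k)) {e : Rn n}
    (hlim : ∀ x, Tendsto (fun k => φ k x) atTop (𝓝 e)) :
    Tendsto (fun k => ∫ p, f p.1 * (w p * inner ℝ (φ k p.2 - φ k p.1) (kernel n α (p.2 - p.1)))
      ∂(volume.prod volume)) atTop (𝓝 0) := by
  have hI := integrable_mul_min_norm_mul_kernel_prod hn hα0 hα1 hf C
  have h0 : ∫ _ : Rn n × Rn n, (0 : ℝ) ∂(volume.prod volume) = 0 := integral_zero _ _
  rw [← h0]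
  refine tendsto_integral_of_dominated_convergence _
    (fun k => hf.1.comp_fst.mul (hw.mul (aestronglyMeasurable_inner_diff_kernel (hφ k).1)))
    (hI.const_mul M) (fun k => Eventually.of_forall fun p => ?_)
    (Eventually.of_forall fun p => ?_)
  · have h1 : ‖inner ℝ (φ k p.2 - φ k p.1) (kernel n α (p.2 - p.1))‖ ≤
        C * (min ‖p.2 - p.1‖ 1 * ‖kernel n α (p.2 - p.1)‖) := by
      rw [← mul_assoc]
      exact (norm_inner_le_norm _ _).trans
        (mul_le_mul_of_nonneg_right ((hφ k).2 _ _) (norm_nonneg _))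
    have hM0 : 0 ≤ M := (norm_nonneg _).trans (hM p)
    rw [norm_mul, norm_mul, mul_left_comm M, Real.norm_eq_abs (f p.1)]
    gcongr
    exact hM p
  · have h1 : Tendsto (fun k => inner ℝ (φ k p.2 - φ k p.1) (kernel n α (p.2 - p.1))) atTop
        (𝓝 (inner ℝ (e - e) (kernel n α (p.2 - p.1)))) :=
      ((hlim p.2).sub (hlim p.1)).inner tendsto_const_nhds
    simpa using (h1.const_mul (w p)).const_mul (f p.1)

/-- An integrable density which represents, on test fields, the integral of `f` against a
fractional divergence has zero mean. -/
theorem integral_eq_zero_of_forall_test (hn : 1 ≤ n) (hα0 : 0 < α) (hα1 : α < 1)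
    (hf : Integrable f) (hf1 : ∀ x, ‖f x‖ ≤ 1) {w : Rn n × Rn n → ℝ} {M : ℝ}
    (hw : AEStronglyMeasurable w (volume.prod volume)) (hM : ∀ p, ‖w p‖ ≤ M) {c : ℝ}
    {m : Measure (Rn n)} {σ : Rn n → Rn n} (hσ : Integrable σ m)
    (h : ∀ φ : Rn n → Rn n, IsTest φ → ∫ x, f x *
      (c * ∫ y, w (x, y) * inner ℝ (φ y - φ x) (kernel n α (y - x))) =
        ∫ x, inner ℝ (φ x) (σ x) ∂m) :
    ∫ x, σ x ∂m = 0 := by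
  obtain ⟨C, η, hC0, hηs, hηc, hη1, hηL, hηt⟩ := exists_cutoff n
  refine ext_inner_left ℝ fun e => ?_
  rw [inner_zero_right, ← integral_inner hσ]
  have ht (k : ℕ) : IsTest fun x => η k x • e :=
    ⟨(hηs k).fun_smul contDiff_const, (hηc k).smul_right⟩
  have t1 := (tendsto_integral_mul_inner_cutoff hn hα0 hα1 hf hw hM
    (fun k => (hηL k).smul_const e) (e := e)
    (fun x => by simpa using (hηt x).smul_const e)).const_mul c
  have t2 : Tendsto (fun k => ∫ x, inner ℝ (η k x • e) (σ x) ∂m) atTop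
      (𝓝 (∫ x, inner ℝ e (σ x) ∂m)) := by
    refine tendsto_integral_of_dominated_convergence (fun x => ‖e‖ * ‖σ x‖)
      (fun k => (ht k).1.continuous.aestronglyMeasurable.inner hσ.1) (hσ.norm.const_mul _)
      (fun k => Eventually.of_forall fun x => ?_) (Eventually.of_forall fun x => ?_)
    · refine (norm_inner_le_norm _ _).trans (mul_le_mul_of_nonneg_right ?_ (norm_nonneg _))
      rw [norm_smul]
      exact mul_le_of_le_one_left (norm_nonneg _) (hη1 k x)
    · have := (hηt x).mul_const (inner ℝ e (σ x))
      simpa only [inner_smul_left, conj_trivial, one_mul] using this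
  rw [mul_zero] at t1
  refine tendsto_nhds_unique t2 (t1.congr fun k => ?_)
  rw [← h _ (ht k), integral_mul_integral_inner (ht k) hn hα0 hα1 hf.1 hf1 hw hM]

end Global

/-! ### Characteristic functions -/

section Chi

variable {n : ℕ} {E : Set (Rn n)}

theorem chi_nonneg (x : Rn n) : 0 ≤ chi E x := indicator_nonneg (fun _ _ => zero_le_one) x

theorem norm_chi_le (x : Rn n) : ‖chi E x‖ ≤ 1 := by
  by_cases hx : x ∈ E <;> simp [chi, hx]

theorem chi_mul_self (x : Rn n) : chi E x * chi E x = chi E x := by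
  by_cases hx : x ∈ E <;> simp [chi, hx]

end Chi

/-! ### Uniqueness of the two measures -/

theorem IsFracVariation.unique {n : ℕ} {α : ℝ} {f : Rn n → ℝ} {D D' : LocVectorMeasure n}
    (hD' : IsFracVariation α f D') (hD : IsFracVariation α f D) : D' = D :=
  locVectorMeasure_eq_of_integral_test_eq fun φ hφ R hR =>
    neg_injective ((hD' φ hφ R hR).symm.trans (hD φ hφ R hR))

theorem IsNLGradientMeasure.unique {n : ℕ} {α : ℝ} {f g : Rn n → ℝ} {N N' : LocVectorMeasure n}
    (hN' : IsNLGradientMeasure α f g N') (hN : IsNLGradientMeasure α f g N) : N' = N :=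
  locVectorMeasure_eq_of_integral_test_eq fun φ hφ R hR =>
    (hN' φ hφ R hR).symm.trans (hN φ hφ R hR)

end FracVar

end

/-! ### The main theorem -/

theorem corollary1p4 (n : ℕ) (hn : 1 ≤ n) (α : ℝ) (hα0 : 0 < α) (hα1 : α < 1)
    (E : Set (FracVar.Rn n)) (hE : FracVar.MemBVloc α ⊤ (FracVar.chi E)) :
    ∃ D N : FracVar.LocVectorMeasure n,
      -- `D = D^α χ_E`, the unique fractional variation measure
      (FracVar.IsFracVariation α (FracVar.chi E) D ∧
        ∀ D', FracVar.IsFracVariation α (FracVar.chi E) D' → D' = D) ∧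
      -- `N = D^α_NL(χ_E, χ_E)` exists and is unique
      (FracVar.IsNLGradientMeasure α (FracVar.chi E) (FracVar.chi E) N ∧
        ∀ N', FracVar.IsNLGradientMeasure α (FracVar.chi E) (FracVar.chi E) N' → N' = N) ∧
      ∃ chiBar : FracVar.Rn n → ℝ,
        MemLp chiBar ⊤ D.variation ∧
        N.EqDensity (fun x => 1 - 2 * chiBar x) D ∧
        (∀ᵐ x ∂D.variation, 0 ≤ chiBar x ∧ chiBar x ≤ 1) ∧
        (∀ᵐ x ∂D.variation, x ∈ FracVar.preciseSet (FracVar.chi E) →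
          chiBar x = FracVar.preciseRep (FracVar.chi E) x) ∧
        -- if `χ_E ∈ BV^{α,1}(ℝⁿ)`, then `D` and `N` are finite measures on `ℝⁿ` and
        -- `N(ℝⁿ) = ∫ chiBar dD = 0`
        (FracVar.MemBV α 1 (FracVar.chi E) →
          ∃ D₁ N₁ : VectorMeasure (FracVar.Rn n) (FracVar.Rn n),
            D.ExtendsTo D₁ ∧ N.ExtendsTo N₁ ∧
            N₁ univ = 0 ∧ D₁.Integrable chiBar ∧ ∫ᵛ x, chiBar x ∂•D₁ = 0) := by
  have hf := hE.1.1
  have hf1 := FracVar.norm_chi_le (E := E)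
  obtain ⟨m, hm, σ, h, hσ, hσR, hh, hh0, hh1, hD, hN, hrep⟩ :=
    FracVar.exists_density_nonlocal hn hα0 hα1 hE hf FracVar.chi_nonneg hf1 FracVar.chi_mul_self
  have hhm : AEStronglyMeasurable (fun x => 1 - 2 * h x) m :=
    (measurable_const.sub (hh.const_mul 2)).aestronglyMeasurable
  have hhb (x : FracVar.Rn n) : |1 - 2 * h x| ≤ 1 :=
    abs_le.2 ⟨by linarith [hh1 x], by linarith [hh0 x]⟩
  have hτR (R : ℝ) : IntegrableOn (fun x => (1 - 2 * h x) • σ x) (Metric.ball 0 R) m :=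
    (hσR R).bdd_smul 1 hhm.restrict (Eventually.of_forall hhb)
  let D := FracVar.LocVectorMeasure.ofDensity m σ hσR
  let N := FracVar.LocVectorMeasure.ofDensity m (fun x => (1 - 2 * h x) • σ x) hτR
  have hDv : FracVar.IsFracVariation α (FracVar.chi E) D := fun φ hφ R hR => by
    rw [FracVar.LocVectorMeasure.integral_dotL_onBall_ofDensity hφ.1.continuous hφ.2 hR]
    exact hD φ hφ
  have hNv : FracVar.IsNLGradientMeasure α (FracVar.chi E) (FracVar.chi E) N :=
    fun φ hφ R hR => by
      rw [FracVar.LocVectorMeasure.integral_dotL_onBall_ofDensity hφ.1.continuous hφ.2 hR]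
      exact hN φ hφ
  have hac : D.variation ≪ m := FracVar.LocVectorMeasure.variation_ofDensity_absolutelyContinuous
  have hn1 (x : FracVar.Rn n) : ‖h x‖ ≤ 1 := by
    rw [Real.norm_of_nonneg (hh0 x)]
    exact hh1 x
  refine ⟨D, N, ⟨hDv, fun D' hD' => hD'.unique hDv⟩, ⟨hNv, fun N' hN' => hN'.unique hNv⟩, h,
    memLp_top_of_bound hh.aestronglyMeasurable 1 (Eventually.of_forall hn1),
    FracVar.LocVectorMeasure.eqDensity_ofDensity hhm hhb hτR,
    Eventually.of_forall fun x => ⟨hh0 x, hh1 x⟩, ?_, ?_⟩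
  · filter_upwards [hac.ae_le hrep] with x hx hxE
    obtain ⟨l, hl⟩ := hxE
    rw [FracVar.preciseRep, hl.limUnder_eq]
    exact hx l hl
  · rintro ⟨hBV, D', hD', hfin⟩
    rw [hD'.unique hDv] at hfin
    -- By uniqueness the finite variation is that of the constructed $D$, so $\sigma$ is integrable
    -- on the whole space and defines the global extension.
    have hσ1 := FracVar.LocVectorMeasure.integrable_of_variation_lt_top
      hσ.aestronglyMeasurable hfin
    have hτ1 : Integrable (fun x => (1 - 2 * h x) • σ x) m :=
      hσ1.bdd_smul 1 hhm (Eventually.of_forall hhb)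
    have hhσ : Integrable (fun x => h x • σ x) m :=
      hσ1.bdd_smul 1 hh.aestronglyMeasurable (Eventually.of_forall hn1)
    have hf2 : Integrable (FracVar.chi E) := memLp_one_iff_integrable.1 hBV.1
    -- The weight $1$ with constant $-\mu_{n,\alpha}$ recovers $-\mathrm{div}^\alpha$.
    have z1 : ∫ x, σ x ∂m = 0 :=
      FracVar.integral_eq_zero_of_forall_test hn hα0 hα1 hf2 hf1 (w := fun _ => 1) (M := 1)
        aestronglyMeasurable_const (by simp) (c := -FracVar.muConst n α) hσ1 fun φ hφ => by
        rw [← neg_neg (∫ x, inner ℝ (φ x) (σ x) ∂m), ← hD φ hφ, FracVar.fracPairing,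
          ← integral_neg]
        congr 1 with x
        rw [FracVar.fracDiv_eq]
        simp only [one_mul]
        ring
    -- The weight $\chi_E(y)-\chi_E(x)$ recovers $\mathrm{div}^\alpha_{\mathrm{NL}}(\chi_E,\cdot)$.
    have z2 : ∫ x, (1 - 2 * h x) • σ x ∂m = 0 :=
      FracVar.integral_eq_zero_of_forall_test hn hα0 hα1 hf2 hf1
        (FracVar.aestronglyMeasurable_difference hf)
        (fun p => FracVar.norm_sub_le_two hf1 p.1 p.2) (c := FracVar.muConst n α) hτ1
        fun φ hφ => by
        rw [← hN φ hφ]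
        simp only [FracVar.fracDivNL_eq]
    -- Solve $\int(1-2h)\sigma=\int\sigma-2\int h\sigma$, where the first two integrals vanish.
    have z3 : ∫ x, h x • σ x ∂m = 0 := by
      have e : ∀ x, (1 - 2 * h x) • σ x = σ x - (2 : ℝ) • h x • σ x := fun x => by
        rw [sub_smul, one_smul, mul_smul]
      have h2 : Integrable (fun x => (2 : ℝ) • h x • σ x) m := hhσ.smul (2 : ℝ)
      simp only [e] at z2
      rw [integral_sub hσ1 h2, z1, integral_smul, zero_sub, neg_eq_zero] at z2
      exact (smul_eq_zero.1 z2).resolve_left two_ne_zero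
    have hhv := FracVar.integrable_withDensity_enorm_of_bound hσ1
      (hh.aestronglyMeasurable (μ := m)) hn1
    refine ⟨m.withDensityᵥ σ, m.withDensityᵥ fun x => (1 - 2 * h x) • σ x, fun A hA hb => ?_,
      fun A hA hb => ?_, ?_, ?_, ?_⟩
    · rw [withDensityᵥ_apply hσ1 hA, FracVar.LocVectorMeasure.ofDensity_apply hA hb]
    · rw [withDensityᵥ_apply hτ1 hA, FracVar.LocVectorMeasure.ofDensity_apply hA hb]
    · rw [withDensityᵥ_apply hτ1 MeasurableSet.univ, setIntegral_univ, z2]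
    · rwa [VectorMeasure.Integrable, Measure.variation_withDensityᵥ hσ1]
    · rw [FracVar.vectorIntegral_withDensityᵥ _ hσ1 hhv]
      exact z3
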